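/- Let $p$ be a prime, $s\ge 1$, $W=W(\overline{\mathbb F}_p)$, $K=\operatorname{Frac}W$ (with $|p|_p=p^{-1}$), and let $\underline a=(a_1,\dots,a_s)\in(\mathbb Q\cap\mathbb Z_p)^s$, $\underline b=(b_1,\dots,b_{s-1})\in\big((\mathbb Q\cap\mathbb Z_p)\setminus\mathbb Z_{\le 0}\big)^{s-1}$. For $\alpha\in\mathbb Z_p$ let $\alpha'=(\alpha+l)/p$, where $l\in\{0,\dots,p-1\}$ and $\alpha+l\equiv 0 \pmod p$; put $\alpha^{(0)}=\alpha$, $\alpha^{(i+1)}=(\alpha^{(i)})'$, and write $\alpha=-\sum_{n\ge 0}[\alpha]_n p^n$ with $[\alpha]_n\in\{0,\dots,p-1\}$. Let $q$ be the number of $j$ with $b_j\ne 1$, and assume: (i) $|b_j^{(i)}|_p=1$ for all $i\ge 0$ and all $j$ with $b_j\neq 1$; (ii) for each $n\ge 0$, once the indices are rearranged (depending on $n$) so that $[a_1]_n\le\dots\le[a_s]_n$ and $[b_1]_n\le\dots\le[b_{s-1}]_n$, one has $[a_{j+1}]_n<[b_j]_n$ for $j=1,\dots,q$. With $(\alpha)_n=\alpha(\alpha+1)\cdots(\alpha+n-1)$,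 put $$F^{(i)}_{\underline a,\underline b}(t)=\sum_{n\ge 0}\frac{(a_1^{(i)})_n\cdots(a_s^{(i)})_n}{(b_1^{(i)})_n\cdots(b_{s-1}^{(i)})_n\,(1)_n}\,t^n,\qquad F_{\underline a,\underline b}=F^{(0)}_{\underline a,\underline b}.$$ Let $\log$ be the Iwasawa logarithm, $\gamma_p=\lim_{m\to\infty}p^{-m}\sum_{0\le j<p^m,\,p\nmid j}\log j$, and $\psi_p(z)=-\gamma_p+\lim_{n\in\mathbb Z_{>0},\,n\to z}\sum_{1\le k<n,\,p\nmid k}\frac1k$ for $z\in\mathbb Z_p$. For $c\in 1+pW$ and $\sigma(t)=ct^p$ put $$G_{\underline a,\underline b}(t)=\sum_{i=1}^{s}\psi_p(a_i)-\sum_{i=1}^{s-1}\psi_p(b_i)+\gamma_p-p^{-1}\log c+\int_0^t\big(F_{\underline a,\underline b}(t)-F^{(1)}_{\underline a,\underline b}(ct^p)\big)\frac{dt}{t},$$ where $\int_0^t(-)\frac{dt}{t}$ sends $\sum_{n\ge1}x_nt^n$ to $\sum_{n\ge1}\frac{x_n}{n}t^n$, and $\mathscr F^{(\sigma)}_{\underline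 a,\underline b}(t)=G_{\underline a,\underline b}(t)/F_{\underline a,\underline b}(t)\in K[[t]]$. Let $[f]_{<n}$ denote the truncation of a power series $f$ to degrees $<n$. Then there is an integer $N_0$, depending only on $p,\underline a,\underline b$, such that for every $N\ge N_0$ the polynomial $h(t)=\prod_{i=0}^N[F^{(i)}_{\underline a,\underline b}(t)]_{<p}$ has coefficients in $W$ and is invertible in $W[[t]]$, and for every $c\in1+pW$ the series $\mathscr F^{(\sigma)}_{\underline a,\underline b}(t)$ lies in $W[[t]]$ and is the expansion of a unique element of $$W\langle t,h(t)^{-1}\rangle=\varprojlim_{n\ge1}\,W[t,h(t)^{-1}]/p^n .$$ Moreover, for every $\alpha\in W$ with $|h(\alpha)|_p=1$, evaluation at $t=\alpha$ sends this element to a well-defined value $\mathscr F^{(\sigma)}_{\underline a,\underline b}(\alpha)\in W$; one has $[F_{\underline a,\underline b}]_{<p^n}(\alpha)\ne0$ for all $n$, and $$\mathscr F^{(\sigma)}_{\underline a,\underline b}(\alpha)=\lim_{n\to\infty}\frac{[G_{\underline a,\underline b}]_{<p^n}(\alpha)}{[F_{\underline a,\underline b}]_{<p^n}(\alpha)} .$$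 -/

import Mathlib

open Filter Topology
open scoped Polynomial

namespace LogHypergeometric

noncomputable section

variable (p : ℕ) [Fact p.Prime]

/-- The Witt ring `W = W(𝔽̄_p)`. -/
abbrev W : Type := WittVector p (AlgebraicClosure (ZMod p))

/-- The fraction field `K` of `W`. -/
abbrev K : Type := FractionRing (W p)

/-- The canonical embedding `ℤ_p = W(𝔽_p) → W`. -/
def zpToW : ℤ_[p] →+* W p :=
  (WittVector.map (algebraMap (ZMod p) (AlgebraicClosure (ZMod p)))).comp
    (WittVector.equiv p).symm.toRingHom

theorem zpToW_injective : Function.Injective (zpToW p) := by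
  intro x y hxy
  exact (WittVector.equiv p).symm.injective (WittVector.map_injective _
    (algebraMap (ZMod p) (AlgebraicClosure (ZMod p))).injective hxy)

/-- The canonical embedding `ℚ_p → K`. -/
def qpToK : ℚ_[p] →+* K p :=
  IsFractionRing.lift (A := ℤ_[p]) (K := ℚ_[p])
    (g := (algebraMap (W p) (K p)).comp (zpToW p))
    ((IsFractionRing.injective (W p) (K p)).comp (zpToW_injective p))

/-- The `p`-adic absolute value on `K`, normalized by `|p|_p = p⁻¹`. -/
def padicAbs : AbsoluteValue (K p) ℝ :=
  (IsDiscreteValuationRing.maximalIdeal (W p)).adicAbv (b := (p : NNReal))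
    (by exact_mod_cast (Fact.out : p.Prime).one_lt)

/-- `x` is the limit of the sequence `u` for the `p`-adic absolute value of `K`. -/
def IsPadicLimit (u : ℕ → K p) (x : K p) : Prop :=
  Tendsto (fun m => padicAbs p (u m - x)) atTop (𝓝 0)

open Classical in
/-- The logarithm `log z = - ∑_{n ≥ 1} (1 - z)ⁿ / n` on the disc `|z - 1|_p < 1` of `K`
(where the series converges). -/
def logK (z : K p) : K p :=
  if h : ∃ x : K p, IsPadicLimit p
      (fun m => - ∑ n ∈ Finset.range m, (1 - z) ^ (n + 1) / ((n : K p) + 1)) x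
  then h.choose else 0

variable {p}

/-- The logarithm `log z = - ∑_{n ≥ 1} (1 - z)ⁿ / n` on the disc `|z - 1|_p < 1` of `ℚ_p`. -/
def logSeries (z : ℚ_[p]) : ℚ_[p] :=
  - ∑' n : ℕ, (1 - z) ^ (n + 1) / ((n : ℚ_[p]) + 1)

/-- The Iwasawa logarithm on `ℚ_pˣ`: write `z = p ^ k * u` with `u` a unit; then
`u ^ (p - 1)` lies in `1 + pℤ_p` and, since `log p = 0`,
`log z = log u = log (u ^ (p - 1)) / (p - 1)`. -/
def iwasawaLog (z : ℚ_[p]) : ℚ_[p] :=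
  logSeries ((z * (p : ℚ_[p]) ^ (-z.valuation)) ^ (p - 1)) / ((p : ℚ_[p]) - 1)

variable (p) in
/-- The `p`-adic Euler constant `γ_p`. -/
def eulerConst : ℚ_[p] :=
  limUnder atTop fun s : ℕ =>
    (∑ j ∈ (Finset.range (p ^ s)).filter (fun j => ¬ p ∣ j), iwasawaLog (j : ℚ_[p]))
      / (p : ℚ_[p]) ^ s

/-- `ψ̃_p(z) = lim ∑_{1 ≤ k < n, p ∤ k} 1 / k`, for positive integers `n` tending
`p`-adically to `z`. -/
def psiTilde (z : ℤ_[p]) : ℚ_[p] :=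
  limUnder (comap (fun n : ℕ => (n : ℤ_[p])) (𝓝 z) ⊓ 𝓟 {n : ℕ | 0 < n}) fun n : ℕ =>
    ∑ k ∈ (Finset.Ico 1 n).filter (fun k => ¬ p ∣ k), ((k : ℚ_[p]))⁻¹

/-- The `p`-adic digamma function `ψ_p`. -/
def psi (z : ℤ_[p]) : ℚ_[p] := - eulerConst p + psiTilde z

/-- The integer `l ∈ {0, …, p - 1}` with `α + l ≡ 0 mod p`. -/
def digitZero (α : ℤ_[p]) : ℕ := (-α).zmodRepr

theorem exists_dworkPrime (α : ℤ_[p]) : ∃ β : ℤ_[p], α + digitZero α = p * β := by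
  have h := (PadicInt.zmodRepr_spec (-α)).2
  rw [PadicInt.maximalIdeal_eq_span_p, Ideal.mem_span_singleton] at h
  obtain ⟨c, hc⟩ := h
  exact ⟨-c, by rw [mul_neg, ← hc, digitZero]; ring⟩

/-- The Dwork prime `α' = (α + l) / p`. -/
def dworkPrime (α : ℤ_[p]) : ℤ_[p] := (exists_dworkPrime α).choose

/-- The `i`-th Dwork prime `α^{(i)}`. -/
def dworkIter (i : ℕ) (α : ℤ_[p]) : ℤ_[p] := dworkPrime^[i] α

/-- The digits `[α]_n` of the expansion `α = - ∑ₙ [α]_n pⁿ`. -/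
def digit (n : ℕ) (α : ℤ_[p]) : ℕ := digitZero (dworkIter n α)

/-- The Pochhammer symbol `(α)_n = α (α + 1) ⋯ (α + n - 1)` in `ℚ_p`. -/
def poch (α : ℤ_[p]) (n : ℕ) : ℚ_[p] := ∏ k ∈ Finset.range n, ((α : ℚ_[p]) + k)

/-- The hypergeometric series `_{s}F_{s-1}(a; b; t)` with `s = r + 1`, over `ℚ_p`. -/
def hypSeries {r : ℕ} (a : Fin (r + 1) → ℤ_[p]) (b : Fin r → ℤ_[p]) : PowerSeries ℚ_[p] :=
  PowerSeries.mk fun n => (∏ i, poch (a i) n) / ((∏ j, poch (b j) n) * poch 1 n)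

/-- The series `F^{(i)}_{a,b}(t)` (with `F^{(0)} = F`), with coefficients viewed in `K`. -/
def hypF {r : ℕ} (a : Fin (r + 1) → ℤ_[p]) (b : Fin r → ℤ_[p]) (i : ℕ) : PowerSeries (K p) :=
  PowerSeries.map (qpToK p)
    (hypSeries (fun k => dworkIter i (a k)) (fun k => dworkIter i (b k)))

/-- The series `f(t^σ) = f(c t^p)`. -/
def substSigma (c : W p) (f : PowerSeries (K p)) : PowerSeries (K p) :=
  PowerSeries.mk fun n =>
    if p ∣ n then (algebraMap (W p) (K p) c) ^ (n / p) * PowerSeries.coeff (n / p) f else 0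

/-- The operator `∫₀ᵗ (-) dt/t`, sending `∑ aₙ tⁿ` (with `a₀ = 0`) to `∑ (aₙ / n) tⁿ`. -/
def integ (f : PowerSeries (K p)) : PowerSeries (K p) :=
  PowerSeries.mk fun n => PowerSeries.coeff n f / (n : K p)

/-- The series `G_{a,b}(t)` attached to the Frobenius `σ(t) = c t^p`. -/
def hypG {r : ℕ} (a : Fin (r + 1) → ℤ_[p]) (b : Fin r → ℤ_[p]) (c : W p) :
    PowerSeries (K p) :=
  PowerSeries.C
      (qpToK p (∑ i, psi (a i) - ∑ j, psi (b j) + eulerConst p)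
        - (p : K p)⁻¹ * logK p (algebraMap (W p) (K p) c))
    + integ (hypF a b 0 - substSigma c (hypF a b 1))

/-- The function `𝓕^{(σ)}_{a,b}(t) = G_{a,b}(t) / F_{a,b}(t)` in `K[[t]]`. -/
def hypLog {r : ℕ} (a : Fin (r + 1) → ℤ_[p]) (b : Fin r → ℤ_[p]) (c : W p) :
    PowerSeries (K p) :=
  hypG a b c * (hypF a b 0)⁻¹

/-- The polynomial `∏_{i=0}^N [F^{(i)}_{a,b}(t)]_{<p}`, a priori with coefficients in `K`. -/
def hypPoly {r : ℕ} (a : Fin (r + 1) → ℤ_[p]) (b : Fin r → ℤ_[p]) (N : ℕ) : (K p)[X] :=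
  ∏ i ∈ Finset.range (N + 1), PowerSeries.trunc p (hypF a b i)

/-- The conditions on the parameters `a`, `b`; here `q` is the number of `j` with `b_j ≠ 1`. -/
structure Admissible {r : ℕ} (a : Fin (r + 1) → ℤ_[p]) (b : Fin r → ℤ_[p]) : Prop where
  rational_a : ∀ i, ∃ x : ℚ, (x : ℚ_[p]) = a i
  rational_b : ∀ j, ∃ x : ℚ, (x : ℚ_[p]) = b j
  b_ne : ∀ j, ∀ m : ℕ, b j ≠ -(m : ℤ_[p])
  norm_b : ∀ j, b j ≠ 1 → ∀ i, ‖dworkIter i (b j)‖ = 1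
  /-- For each `n`, once the digits are rearranged in increasing order,
  `[a_{j+1}]_n < [b_j]_n` for `j = 1, …, q`. -/
  digits : ∀ n : ℕ, ∀ (ρ : Equiv.Perm (Fin (r + 1))) (τ : Equiv.Perm (Fin r)),
    Monotone (fun i => digit n (a (ρ i))) → Monotone (fun j => digit n (b (τ j))) →
    ∀ j : Fin r, (j : ℕ) < Nat.card {k : Fin r // b k ≠ 1} →
      digit n (a (ρ j.succ)) < digit n (b (τ j))

/-- The ring `W[t, h(t)⁻¹]`. -/
abbrev LocRing (h : (W p)[X]) : Type := Localization.Away h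

/-- The Tate algebra `W⟨t, h(t)⁻¹⟩ = lim_n W[t, h(t)⁻¹] / pⁿ`. -/
abbrev TateAlg (h : (W p)[X]) : Type :=
  AdicCompletion (Ideal.span {(p : LocRing h)}) (LocRing h)

theorem span_pow_le {p : ℕ} {A B : Type*} [CommRing A] [CommRing B] (φ : A →+* B) (n : ℕ) :
    Ideal.span {(p : A)} ^ n ≤ (Ideal.span {(p : B)} ^ n).comap φ := by
  rw [← Ideal.map_le_iff_le_comap, Ideal.map_pow, Ideal.map_span]
  simp

/-- For a ring homomorphism `φ : W[t, h⁻¹] → B`: the element `x` of `B` is the image of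
`f ∈ W⟨t, h⁻¹⟩` under the `p`-adic continuation of `φ`, that is,
`x mod pⁿ` is the image of `f mod pⁿ` under `W[t, h⁻¹] / pⁿ → B / pⁿ` for every `n`. -/
def IsImage {h : (W p)[X]} {B : Type*} [CommRing B] (φ : LocRing h →+* B)
    (f : TateAlg h) (x : B) : Prop :=
  ∀ n : ℕ,
    Ideal.quotientMap (Ideal.span {(p : B)} ^ n) φ (span_pow_le φ n)
      (AdicCompletion.evalₐ (Ideal.span {(p : LocRing h)}) n f)
      = Ideal.Quotient.mk (Ideal.span {(p : B)} ^ n) x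

/-- The expansion homomorphism `W[t, h⁻¹] → W[[t]]`, for `h` invertible in `W[[t]]`. -/
def toSeries (h : (W p)[X]) (hu : IsUnit (h : PowerSeries (W p))) :
    LocRing h →+* PowerSeries (W p) :=
  Localization.awayLift (Polynomial.coeToPowerSeries.ringHom (R := W p)) h hu

/-- The evaluation homomorphism `W[t, h⁻¹] → W` at `t = α`, for `h(α)` invertible in `W`. -/
def evalAt (h : (W p)[X]) (α : W p) (hu : IsUnit (h.eval α)) : LocRing h →+* W p :=
  Localization.awayLift (Polynomial.evalRingHom α) h hu

end

end LogHypergeometric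

open LogHypergeometric

/-! Write `f_{<m}` for truncation and `A_k`, `q(k) A_k` for the coefficients of `F` and `G`. The
heart is a Dwork congruence in `W[[t]]`: `G * F_{<p^(n+1)} ≡ G_{<p^(n+1)} * F` mod `p^n`
(`pow_dvd_coeff_mul_trunc_sub`). Hence `G/F` is the `p`-adic limit of the quotients `G_{<p^(n+1)} /
F_{<p^(n+1)}`.

These quotients make sense in `W[t, h⁻¹]` modulo every power of `p`. Indeed `F_{<p^m}` is congruent
mod `p` to the product of the `(F^{(k)}_{<p})^(p^k)`, `k < m` (`IsDworkSystem.dvd_trunc_sub_prod`).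
Rational parameters have only finitely many Dwork primes, so for large `N` each factor divides `h`.
As expansion in `W[[t]]` reflects divisibility by `p^n` (`pow_dvd_of_toSeries`), the quotients
define exactly one element of the Tate algebra; evaluating them at `α` gives the limit formula.

The congruence has two inputs. First, `A^{(i)}_{v+pz}` is a Lipschitz factor times a coefficient of
level `i+1` at `z`. Denominators `b_j + z` may appear there, so the sequences are enlarged by states
recording these factors. The condition on digits says precisely that each nonempty state comes with
a spare factor `p` (`Admissible.exists_digit_relation`). Antisymmetric sums of products of
coefficients are then divisible by `p^m`, by induction on digits (`dvd_crossSum`).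

Second, `p * q(k)` is `p`-adically Lipschitz in `k` (`exists_weight`). For `p ∤ k` one has `q(k) =
1/k`. For `k = p l` with `l > 0` one has `q(k) = (1 - c^l / γ(l)) / (p l)`, where `γ(l)` is the
ratio of `A^{(0)}_{pl}` to `A^{(1)}_l`. Both `c^l` and `γ(l)` have the form `1 + p l Φ(l)` with `Φ`
Lipschitz, and their `Φ(0)` are `p⁻¹ log c` and a difference of sums of `p`-adic digamma values.
Thus the constant term of `G` is exactly the continuous extension of `q` to `k = 0`. -/

namespace LogHypergeometric

/-! ### Calculus of `p`-adically Lipschitz sequences. -/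

section Lipschitz

variable {Q : Type*} [CommRing Q]

/-- `w` is `p`-adically Lipschitz with a gain of `e` digits:
`z ≡ z' mod p ^ k` implies `w z ≡ w z' mod p ^ (k + e)`. -/
def IsLip (p e : ℕ) (w : ℕ → Q) : Prop :=
  ∀ k z z', z ≡ z' [MOD p ^ k] → (p : Q) ^ (k + e) ∣ w z - w z'

/-- The two-variable version of `IsLip`. -/
def IsLip₂ (p e : ℕ) (w : ℕ → ℕ → Q) : Prop :=
  ∀ k x x' y y', x ≡ x' [MOD p ^ k] → y ≡ y' [MOD p ^ k] →
    (p : Q) ^ (k + e) ∣ w x y - w x' y'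

variable {p e : ℕ}

theorem dvd_mul_sub_mul {a b c d x : Q} (h₁ : x ∣ a - c) (h₂ : x ∣ b - d) :
    x ∣ a * b - c * d := by
  have : a * b - c * d = (a - c) * b + c * (b - d) := by ring
  rw [this]
  exact dvd_add (h₁.mul_right _) (h₂.mul_left _)

theorem IsLip.const (p e : ℕ) (c : Q) : IsLip p e fun _ => c := fun k z z' _ => by simp

theorem IsLip.mul {v w : ℕ → Q} (hv : IsLip p e v) (hw : IsLip p e w) :
    IsLip p e fun z => v z * w z :=
  fun k z z' h => dvd_mul_sub_mul (hv k z z' h) (hw k z z' h)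

theorem IsLip.add {v w : ℕ → Q} (hv : IsLip p e v) (hw : IsLip p e w) :
    IsLip p e fun z => v z + w z := fun k z z' h => by
  rw [add_sub_add_comm]; exact dvd_add (hv k z z' h) (hw k z z' h)

theorem IsLip.neg {v : ℕ → Q} (hv : IsLip p e v) : IsLip p e fun z => - v z := fun k z z' h => by
  rw [← neg_sub', dvd_neg]; exact hv k z z' h

theorem IsLip.prod {ι : Type*} (s : Finset ι) {w : ι → ℕ → Q} (hw : ∀ i ∈ s, IsLip p e (w i)) :
    IsLip p e fun z => ∏ i ∈ s, w i z := by
  classical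
  induction s using Finset.induction_on with
  | empty => simpa using IsLip.const p e (1 : Q)
  | insert i s hi ih =>
    simp only [Finset.prod_insert hi]
    exact (hw i (Finset.mem_insert_self i s)).mul
      (ih fun j hj => hw j (Finset.mem_insert_of_mem hj))

theorem IsLip.inv {u : ℕ → Qˣ} (hu : IsLip p e fun z => (u z : Q)) :
    IsLip p e fun z => ((u z)⁻¹ : Qˣ).val := fun k z z' h => by
  have : ((u z)⁻¹ : Qˣ).val - ((u z')⁻¹ : Qˣ).val
      = -((u z : Q) - u z') * (((u z)⁻¹ : Qˣ).val * ((u z')⁻¹ : Qˣ).val) := by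
    have h1 := (u z).mul_inv
    have h2 := (u z').mul_inv
    linear_combination ((u z')⁻¹ : Qˣ).val * h1 - ((u z)⁻¹ : Qˣ).val * h2
  rw [this]
  exact ((dvd_neg.2 (hu k z z' h))).mul_right _

theorem IsLip.mono {e' : ℕ} (hee : e' ≤ e) {w : ℕ → Q} (hw : IsLip p e w) : IsLip p e' w :=
  fun k z z' h => (pow_dvd_pow _ (by omega)).trans (hw k z z' h)

theorem IsLip.p_mul {w : ℕ → Q} (hw : IsLip p e w) : IsLip p (e + 1) fun z => p * w z :=
  fun k z z' h => by
    rw [← mul_sub, ← add_assoc, pow_succ']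
    exact mul_dvd_mul_left _ (hw k z z' h)

theorem IsLip.pow_mul {w : ℕ → Q} (n : ℕ) (hw : IsLip p e w) :
    IsLip p (e + n) fun z => (p : Q) ^ n * w z :=
  fun k z z' h => by
    rw [← mul_sub, ← add_assoc, pow_add, mul_comm]
    exact mul_dvd_mul_left _ (hw k z z' h)

theorem dvd_cast_sub_cast {k z z' : ℕ} (h : z ≡ z' [MOD p ^ k]) :
    (p : Q) ^ k ∣ (z : Q) - z' := by
  have h1 : ((p ^ k : ℕ) : ℤ) ∣ (z : ℤ) - z' := (Nat.modEq_iff_dvd.1 h.symm)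
  have h2 := (Int.castRingHom Q).map_dvd h1
  simpa using h2

theorem isLip_cast : IsLip p 0 fun z : ℕ => (z : Q) :=
  fun _ _ _ h => by simpa using dvd_cast_sub_cast h

theorem isLip_add_cast (c : Q) : IsLip p 0 fun z : ℕ => c + z :=
  (IsLip.const p 0 c).add isLip_cast

/-- If `z` is known mod `p^k`, then `v + p z` is known mod `p^(k+1)`: fixing the last digit gains
one digit. -/
theorem IsLip.comp_digit {w : ℕ → Q} (hw : IsLip p e w) (v : ℕ) :
    IsLip p (e + 1) fun z => w (v + p * z) := fun k z z' h => by
  have := hw (k + 1) (v + p * z) (v + p * z')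
    (Nat.ModEq.add_left _ (by rw [pow_succ']; exact Nat.ModEq.mul_left' _ h))
  rwa [show k + (e + 1) = k + 1 + e by ring]

theorem IsLip.map {Q' : Type*} [CommRing Q'] (φ : Q →+* Q') {w : ℕ → Q} (hw : IsLip p e w) :
    IsLip p e fun z => φ (w z) := fun k z z' h => by
  have := φ.map_dvd (hw k z z' h)
  simpa using this

theorem IsLip₂.mul {v w : ℕ → ℕ → Q} (hv : IsLip₂ p e v) (hw : IsLip₂ p e w) :
    IsLip₂ p e fun x y => v x y * w x y :=
  fun k x x' y y' h h' => dvd_mul_sub_mul (hv k x x' y y' h h') (hw k x x' y y' h h')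

theorem IsLip.left {w : ℕ → Q} (hw : IsLip p e w) : IsLip₂ p e fun x _ => w x :=
  fun k x x' _ _ h _ => hw k x x' h

theorem IsLip.right {w : ℕ → Q} (hw : IsLip p e w) : IsLip₂ p e fun _ y => w y :=
  fun k _ _ y y' _ h => hw k y y' h

theorem IsLip₂.mono {e' : ℕ} (hee : e' ≤ e) {w : ℕ → ℕ → Q} (hw : IsLip₂ p e w) :
    IsLip₂ p e' w :=
  fun k x x' y y' h h' => (pow_dvd_pow _ (by omega)).trans (hw k x x' y y' h h')

theorem IsLip₂.comp_digit {w : ℕ → ℕ → Q} (hw : IsLip₂ p e w) (u v : ℕ) :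
    IsLip₂ p (e + 1) fun x y => w (u + p * x) (v + p * y) := fun k x x' y y' h h' => by
  have := hw (k + 1) (u + p * x) (u + p * x') (v + p * y) (v + p * y')
    (Nat.ModEq.add_left _ (by rw [pow_succ']; exact Nat.ModEq.mul_left' _ h))
    (Nat.ModEq.add_left _ (by rw [pow_succ']; exact Nat.ModEq.mul_left' _ h'))
  rwa [show k + (e + 1) = k + 1 + e by ring]

end Lipschitz

theorem sum_range_mul_eq {M : Type*} [AddCommMonoid M] (p n : ℕ) (F : ℕ → M) :
    ∑ i ∈ Finset.range (p * n), F i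
      = ∑ v ∈ Finset.range p, ∑ z ∈ Finset.range n, F (v + p * z) := by
  induction n with
  | zero => simp
  | succ n ih =>
    simp only [Finset.sum_range_succ, Finset.sum_add_distrib]
    rw [mul_add, mul_one, Finset.sum_range_add, ih]
    simp [add_comm]

/-! ### Digit relations and the divisibility of antisymmetric sums. -/

section System

/-- A system of sequences `A i S` (level `i`, state `S`) satisfying Dwork type relations
`A i S (v + p z) = V z * A (i + 1) S' z`, with a distinguished state `o`. -/
def IsDworkSystem {Q : Type*} [CommRing Q] (p : ℕ) {St : Type*} (o : St)
    (A : ℕ → St → ℕ → Q) : Prop :=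
  ∀ i S v, v < p → ∃ (S' : St) (V : ℕ → Q), (∀ z, A i S (v + p * z) = V z * A (i + 1) S' z) ∧
    IsLip p 1 V ∧ (S' = o ∨ ∃ V₂ : ℕ → Q, IsLip p 0 V₂ ∧ ∀ z, V z = p * V₂ z)

variable {Q : Type*} [CommRing Q] {p : ℕ} {St : Type*} {o : St} {A : ℕ → St → ℕ → Q}

theorem IsDworkSystem.map {Q' : Type*} [CommRing Q'] (φ : Q →+* Q') (hA : IsDworkSystem p o A) :
    IsDworkSystem p o fun i S z => φ (A i S z) := by
  intro i S v hv
  obtain ⟨S', V, h1, h2, h3⟩ := hA i S v hv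
  refine ⟨S', fun z => φ (V z), fun z => by simp [h1], h2.map φ, h3.imp id ?_⟩
  rintro ⟨V₂, h4, h5⟩
  exact ⟨fun z => φ (V₂ z), h4.map φ, fun z => by simp [h5]⟩

/-- The antisymmetric sums that measure the failure of truncation to commute with products. -/
def crossSum (X Y : ℕ → Q) (M x y : ℕ) (w : ℕ → ℕ → Q) (t : Q) : Q :=
  ∑ e ∈ Finset.range M, ∑ f ∈ Finset.range M,
    w e f * (X (f + M * x) * Y (e + M * y) - X (f + M * y) * Y (e + M * x)) * t ^ (e + f)

/-- For a constant weight and `X = Y` the summand changes sign when `e` and `f` are exchanged. -/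
theorem crossSum_const (X : ℕ → Q) (M x y : ℕ) (c t : Q) :
    crossSum X X M x y (fun _ _ => c) t = 0 := by
  have h : ∀ g : ℕ → ℕ → Q, ∑ e ∈ Finset.range M, ∑ f ∈ Finset.range M, (g e f - g f e) = 0 := by
    intro g
    simp only [Finset.sum_sub_distrib]
    rw [Finset.sum_comm, sub_self]
  rw [← h fun e f => c * (X (f + M * x) * X (e + M * y)) * t ^ (e + f), crossSum]
  refine Finset.sum_congr rfl fun e _ => Finset.sum_congr rfl fun f _ => ?_
  rw [add_comm f e]; ring

theorem crossSum_add_mul (X Y : ℕ → Q) (M x y : ℕ) (c d t : Q) (w : ℕ → ℕ → Q) :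
    crossSum X Y M x y (fun e f => c + d * w e f) t
      = crossSum X Y M x y (fun _ _ => c) t + d * crossSum X Y M x y w t := by
  simp only [crossSum, Finset.mul_sum, ← Finset.sum_add_distrib]
  refine Finset.sum_congr rfl fun e _ => Finset.sum_congr rfl fun f _ => ?_
  ring

/-- Induction on `m`, splitting off the lowest digits `e₀`, `f₀`. Modulo `p^(m+1)` each pair of
digits leaves a sum of the same kind at level `i + 1`, with `p^m` terms per variable and the factors
`V` absorbed into the weight. Allowing an arbitrary weight and two different states is what makes
the induction close. -/
theorem dvd_crossSum [IsDomain Q] (hp : (p : Q) ≠ 0) (hA : IsDworkSystem p o A) (m : ℕ) :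
    ∀ (i : ℕ) (S T : St) (x y : ℕ) (w : ℕ → ℕ → Q) (t : Q), IsLip₂ p 0 w →
      (p : Q) ^ m ∣ crossSum (A i S) (A i T) (p ^ m) x y w t := by
  induction m with
  | zero => intros; simp
  | succ m ih =>
    intro i S T x y w t hw
    rw [crossSum, pow_succ' p m, sum_range_mul_eq]
    simp_rw [sum_range_mul_eq p (p ^ m)]
    refine Finset.dvd_sum fun e₀ he₀ => ?_
    rw [Finset.sum_comm]
    refine Finset.dvd_sum fun f₀ hf₀ => ?_
    obtain ⟨T', Ve, hTe, hVe, hVe'⟩ := hA i T e₀ (Finset.mem_range.1 he₀)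
    obtain ⟨S', Vf, hSf, hVf, hVf'⟩ := hA i S f₀ (Finset.mem_range.1 hf₀)
    set W : ℕ → ℕ → Q := fun e f => w (e₀ + p * e) (f₀ + p * f) * (Ve e * Vf f) with hW
    have key : (p : Q) ^ (m + 1) ∣ crossSum (A (i + 1) S') (A (i + 1) T') (p ^ m) x y W (t ^ p) := by
      -- If the new weight is `c + p W₂`, the part from `p W₂` gets `p^m` by induction and one more
      -- `p`; the part from `c` has to vanish.
      have hred : ∀ W₂ : ℕ → ℕ → Q, IsLip₂ p 0 W₂ → ∀ c : Q, (∀ e f, W e f = c + p * W₂ e f) →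
          crossSum (A (i + 1) S') (A (i + 1) T') (p ^ m) x y (fun _ _ => c) (t ^ p) = 0 →
          (p : Q) ^ (m + 1) ∣
            crossSum (A (i + 1) S') (A (i + 1) T') (p ^ m) x y W (t ^ p) := by
        intro W₂ h₂ c hc h0
        have : W = fun e f => c + p * W₂ e f := by funext e f; exact hc e f
        rw [this, crossSum_add_mul, h0, zero_add, pow_succ']
        exact mul_dvd_mul_left _ (ih (i + 1) S' T' x y W₂ (t ^ p) h₂)
      have hz : crossSum (A (i + 1) S') (A (i + 1) T') (p ^ m) x y (fun _ _ => 0) (t ^ p) = 0 := by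
        simp [crossSum]
      have hw1 := hw.comp_digit e₀ f₀
      have hw0 := hw1.mono (e' := 0) (by omega)
      rcases hVe' with hT' | ⟨V₂, h₂, hV₂⟩
      · rcases hVf' with hS' | ⟨V₂, h₂, hV₂⟩
        · subst hT' hS'
          -- Both states are `o`: gain 1 makes `W - W 0 0` equal to `p` times a Lipschitz weight,
          -- and the constant part vanishes by antisymmetry. In the other cases a factor `V` already
          -- supplies `p`, with `c = 0`.
          have hWlip : IsLip₂ p 1 W := hw1.mul (hVe.left.mul hVf.right)
          have hdiv : ∀ e f, ∃ d, W e f - W 0 0 = p * d := fun e f => by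
            simpa [dvd_def] using hWlip 0 e 0 f 0 (by simp [Nat.modEq_one])
              (by simp [Nat.modEq_one])
          choose W₂ hW₂ using hdiv
          refine hred W₂ ?_ (W 0 0) (fun e f => by rw [← hW₂]; ring) (crossSum_const _ _ _ _ _ _)
          intro k e e' f f' h h'
          have h1 := hWlip k e e' f f' h h'
          rw [show W e f - W e' f' = p * (W₂ e f - W₂ e' f') by
            rw [mul_sub, ← hW₂, ← hW₂]; ring, pow_succ'] at h1
          exact (mul_dvd_mul_iff_left hp).1 h1
        · exact hred (fun e f => w (e₀ + p * e) (f₀ + p * f) * (Ve e * V₂ f))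
            (hw0.mul ((hVe.mono (Nat.zero_le _)).left.mul h₂.right)) 0
            (fun e f => by simp only [hW, hV₂]; ring) hz
      · exact hred (fun e f => w (e₀ + p * e) (f₀ + p * f) * (V₂ e * Vf f))
          (hw0.mul (h₂.left.mul (hVf.mono (Nat.zero_le _)).right)) 0
          (fun e f => by simp only [hW, hV₂]; ring) hz
    refine (dvd_iff_dvd_of_dvd_sub ?_).2 (key.mul_left (t ^ (e₀ + f₀)))
    rw [crossSum, Finset.mul_sum, ← Finset.sum_sub_distrib]
    refine Finset.dvd_sum fun e _ => ?_
    rw [Finset.mul_sum, ← Finset.sum_sub_distrib]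
    refine Finset.dvd_sum fun f _ => ?_
    -- As `V` gains a digit, shifting its argument by `p^m x` is invisible mod `p^(m+1)`, so the
    -- factors `V` depend only on `e` and `f`.
    have hshift : ∀ {V : ℕ → Q}, IsLip p 1 V → ∀ z x, (p : Q) ^ (m + 1) ∣ V (z + p ^ m * x) - V z :=
      fun hV z x => hV m _ _ (by simp [Nat.ModEq])
    have e1 : ∀ v z x, v + p * z + p * p ^ m * x = v + p * (z + p ^ m * x) := by intros; ring
    have hx := dvd_mul_sub_mul (hshift hVf f x) (hshift hVe e y)
    have hy := dvd_mul_sub_mul (hshift hVf f y) (hshift hVe e x)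
    have e2 : t ^ (e₀ + p * e + (f₀ + p * f)) = t ^ (e₀ + f₀) * (t ^ p) ^ (e + f) := by
      rw [← pow_mul, ← pow_add]; congr 1; ring
    simp only [e1, e2, hTe, hSf, hW]
    have : ∀ a b c d u v u' v' w s s' g : Q,
        w * (a * u * (b * v) - c * u' * (d * v')) * (s * s')
          - s * (w * (g) * (u * v - u' * v') * s')
        = (a * b - g) * (w * u * v * s * s') - (c * d - g) * (w * u' * v' * s * s') := by
      intros; ring
    rw [this]
    refine dvd_sub (Dvd.dvd.mul_right ?_ _) (Dvd.dvd.mul_right ?_ _)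
    · rw [mul_comm (Ve e)]; exact hx
    · rw [mul_comm (Ve e)]; exact hy

end System

/-! ### Dwork congruence between truncations of `F` and `G`. -/

section Truncation

variable {R : Type*} [CommRing R] {p : ℕ} {St : Type*} {o : St} {A : ℕ → St → ℕ → R}

theorem trunc_mk_eq_sum (n : ℕ) (B : ℕ → R) :
    PowerSeries.trunc n (PowerSeries.mk B)
      = ∑ i ∈ Finset.range n, Polynomial.C (B i) * Polynomial.X ^ i := by
  ext k
  simp [PowerSeries.coeff_trunc, Polynomial.finsetSum_coeff, Polynomial.coeff_X_pow]

/-- The long truncation is cut into blocks of length `M = p^m`. Block `y` contributes the weights `c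
(f + M y) - c e` with `c = p q`. Replacing `c (f + M y)` by `c f` costs a multiple of `p^m`; after
exchanging `e` and `f` in one term, the rest is an antisymmetric sum. -/
theorem dvd_trunc_mul_sub [IsDomain R] (hp : (p : R) ≠ 0) (hA : IsDworkSystem p o A)
    {q : ℕ → R} (hq : IsLip p 0 fun k => p * q k) (i m Y : ℕ) :
    (p : R[X]) ^ m ∣ p *
      (PowerSeries.trunc (p ^ m * Y) (PowerSeries.mk fun k => q k * A i o k)
          * PowerSeries.trunc (p ^ m) (PowerSeries.mk (A i o))
        - PowerSeries.trunc (p ^ m) (PowerSeries.mk fun k => q k * A i o k)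
          * PowerSeries.trunc (p ^ m * Y) (PowerSeries.mk (A i o))) := by
  set M := p ^ m with hM
  simp only [trunc_mk_eq_sum, sum_range_mul_eq M Y]
  have hpX : (p : R[X]) ≠ 0 := by
    rw [← map_natCast (Polynomial.C : R →+* R[X])]
    exact Polynomial.C_ne_zero.2 hp
  set a : ℕ → R[X] := fun k => Polynomial.C (A i o k) with ha
  set c : ℕ → R[X] := fun k => Polynomial.C (p * q k) with hc
  have hcl : IsLip p 0 c := hq.map Polynomial.C
  have key : ∀ y, (p : R[X]) ^ m ∣ ∑ e ∈ Finset.range M, ∑ f ∈ Finset.range M,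
      (c (f + M * y) - c e) * a e * a (f + M * y) * Polynomial.X ^ (e + f) := by
    intro y
    have h1 := dvd_crossSum hpX (hA.map (Polynomial.C : R →+* R[X])) m i o o 0 y
      (fun e _ => c e) Polynomial.X hcl.left
    have h2 : (p : R[X]) ^ m ∣ ∑ e ∈ Finset.range M, ∑ f ∈ Finset.range M,
      (c (f + M * y) - c f) * a e * a (f + M * y) * Polynomial.X ^ (e + f) := by
      refine Finset.dvd_sum fun e _ => Finset.dvd_sum fun f _ => ?_
      refine Dvd.dvd.mul_right (Dvd.dvd.mul_right (Dvd.dvd.mul_right ?_ _) _) _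
      simpa using hcl m (f + M * y) f (by simp [Nat.ModEq, hM])
    have h3 : ∑ e ∈ Finset.range M, ∑ f ∈ Finset.range M,
          c f * a e * a (f + M * y) * Polynomial.X ^ (e + f)
        = ∑ e ∈ Finset.range M, ∑ f ∈ Finset.range M,
          c e * a f * a (e + M * y) * Polynomial.X ^ (e + f) := by
      rw [Finset.sum_comm]
      simp_rw [add_comm]
    convert dvd_add h2 h1 using 1
    rw [crossSum, ← hM]
    have h4 : ∀ e f, (c (f + M * y) - c e) * a e * a (f + M * y) * Polynomial.X ^ (e + f)
        = (c (f + M * y) - c f) * a e * a (f + M * y) * Polynomial.X ^ (e + f)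
          + (c f * a e * a (f + M * y) * Polynomial.X ^ (e + f)
            - c e * a e * a (f + M * y) * Polynomial.X ^ (e + f)) := by intros; ring
    simp only [h4, Finset.sum_add_distrib, Finset.sum_sub_distrib, h3]
    simp only [← Finset.sum_sub_distrib, ← Finset.sum_add_distrib]
    refine Finset.sum_congr rfl fun e _ => Finset.sum_congr rfl fun f _ => ?_
    simp only [mul_zero, add_zero]
    ring
  have : (p : R[X]) * ((∑ v ∈ Finset.range M, ∑ z ∈ Finset.range Y,
        Polynomial.C (q (v + M * z) * A i o (v + M * z)) * Polynomial.X ^ (v + M * z))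
          * ∑ e ∈ Finset.range M, Polynomial.C (A i o e) * Polynomial.X ^ e
      - (∑ e ∈ Finset.range M, Polynomial.C (q e * A i o e) * Polynomial.X ^ e)
          * ∑ v ∈ Finset.range M, ∑ z ∈ Finset.range Y,
            Polynomial.C (A i o (v + M * z)) * Polynomial.X ^ (v + M * z))
      = ∑ y ∈ Finset.range Y, Polynomial.X ^ (M * y) *
        ∑ e ∈ Finset.range M, ∑ f ∈ Finset.range M,
          (c (f + M * y) - c e) * a e * a (f + M * y) * Polynomial.X ^ (e + f) := by
    have hsw : ∀ F : ℕ → ℕ → R[X], ∑ v ∈ Finset.range M, ∑ z ∈ Finset.range Y, F v z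
        = ∑ z ∈ Finset.range Y, ∑ v ∈ Finset.range M, F v z := fun F => Finset.sum_comm
    rw [hsw, hsw]
    simp only [Finset.sum_mul, Finset.mul_sum, mul_sub]
    rw [Finset.sum_comm (s := Finset.range M) (t := Finset.range Y)]
    rw [← Finset.sum_sub_distrib]
    refine Finset.sum_congr rfl fun y _ => ?_
    rw [Finset.sum_comm, ← Finset.sum_sub_distrib]
    conv_rhs => rw [Finset.sum_comm]
    refine Finset.sum_congr rfl fun e _ => ?_
    rw [← Finset.sum_sub_distrib]
    refine Finset.sum_congr rfl fun f _ => ?_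
    simp only [ha, hc, map_mul, map_natCast]
    ring
  rw [this]
  exact Finset.dvd_sum fun y _ => (key y).mul_left _

/-- Only `p q`, not `q`, is Lipschitz, which costs one power of `p`; hence the truncation at
`p^(m+1)`. The `n`-th coefficient cannot tell a series from a truncation beyond degree `n`. -/
theorem pow_dvd_coeff_mul_trunc_sub [IsDomain R] (hp : (p : R) ≠ 0) (hA : IsDworkSystem p o A)
    {q : ℕ → R} (hq : IsLip p 0 fun k => p * q k) (i m n : ℕ) :
    (p : R) ^ m ∣ PowerSeries.coeff n
      ((PowerSeries.mk fun k => q k * A i o k)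
          * (PowerSeries.trunc (p ^ (m + 1)) (PowerSeries.mk (A i o)) : PowerSeries R)
        - (PowerSeries.trunc (p ^ (m + 1)) (PowerSeries.mk fun k => q k * A i o k) : PowerSeries R)
          * PowerSeries.mk (A i o)) := by
  have hp0 : 0 < p := Nat.pos_of_ne_zero (by rintro rfl; simp at hp)
  have h := dvd_trunc_mul_sub hp hA hq i (m + 1) (n + 1)
  rw [pow_succ', mul_dvd_mul_iff_left] at h
  swap
  · rw [← map_natCast (Polynomial.C : R →+* R[X])]
    exact Polynomial.C_ne_zero.2 hp
  rw [← map_natCast (Polynomial.C : R →+* R[X]), ← map_pow, Polynomial.C_dvd_iff_dvd_coeff] at h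
  have hn : n < p ^ (m + 1) * (n + 1) :=
    lt_of_lt_of_le (Nat.lt_succ_self n) (Nat.le_mul_of_pos_left _ (pow_pos hp0 _))
  convert h n using 1
  rw [Polynomial.coeff_sub, map_sub, ← Polynomial.coeff_coe, ← Polynomial.coeff_coe,
    Polynomial.coe_mul, Polynomial.coe_mul]
  congr 1
  · rw [PowerSeries.coeff_mul, PowerSeries.coeff_mul]
    refine Finset.sum_congr rfl fun x hx => ?_
    have := Finset.HasAntidiagonal.mem_antidiagonal.1 hx
    rw [Polynomial.coeff_coe _ x.1, PowerSeries.coeff_trunc, if_pos (by omega)]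
  · rw [PowerSeries.coeff_mul, PowerSeries.coeff_mul]
    refine Finset.sum_congr rfl fun x hx => ?_
    have := Finset.HasAntidiagonal.mem_antidiagonal.1 hx
    rw [Polynomial.coeff_coe _ x.2, PowerSeries.coeff_trunc, if_pos (by omega)]

/-- If the new state is `o`, then `V` is constant mod `p`, with `V 0` read off at `z = 0`. Otherwise
`p` divides both terms. -/
theorem IsDworkSystem.dvd_sub_mul (hA : IsDworkSystem p o A) (h1 : ∀ i, A i o 0 = 1)
    (i v z : ℕ) (hv : v < p) :
    (p : R) ∣ A i o (v + p * z) - A i o v * A (i + 1) o z := by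
  obtain ⟨S', V, hV, hL, hS⟩ := hA i o v hv
  have hv0 : A i o v = V 0 * A (i + 1) S' 0 := by simpa using hV 0
  rcases hS with rfl | ⟨V₂, -, hV₂⟩
  · rw [hV, hv0, h1, mul_one, ← sub_mul]
    exact Dvd.dvd.mul_right (by simpa using hL 0 z 0 (by simp [Nat.modEq_one])) _
  · rw [hV, hv0, hV₂, hV₂]
    exact dvd_sub (by simp [mul_assoc]) (by simp [mul_assoc])

end Truncation

/-! ### Factorization of truncations modulo `p`. -/

section ModP

variable {p : ℕ} [Fact p.Prime]

theorem natCast_dvd_iff_map_toZMod {f : ℤ_[p][X]} :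
    (p : ℤ_[p][X]) ∣ f ↔ f.map PadicInt.toZMod = 0 := by
  rw [← map_natCast (Polynomial.C : ℤ_[p] →+* ℤ_[p][X]), Polynomial.C_dvd_iff_dvd_coeff,
    Polynomial.ext_iff]
  refine forall_congr' fun n => ?_
  rw [Polynomial.coeff_map, Polynomial.coeff_zero, ← RingHom.mem_ker, PadicInt.ker_toZMod,
    PadicInt.maximalIdeal_eq_span_p, Ideal.mem_span_singleton]

theorem natCast_dvd_expand_sub_pow (f : ℤ_[p][X]) :
    (p : ℤ_[p][X]) ∣ Polynomial.expand ℤ_[p] p f - f ^ p := by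
  rw [natCast_dvd_iff_map_toZMod, Polynomial.map_sub, Polynomial.map_expand, Polynomial.map_pow,
    ZMod.expand_card, sub_self]

variable {St : Type*} {o : St} {A : ℕ → St → ℕ → ℤ_[p]}

/-- The digit relation mod `p` gives a factorization with `f(t^p)` in place of `f^p`. The two agree
mod `p` because the coefficients lie in `ℤ_p`, whose residue field is fixed by Frobenius; this is
why the statement is over `ℤ_p` and not over `W`. -/
theorem IsDworkSystem.dvd_trunc_sub_mul_pow (hA : IsDworkSystem p o A) (h1 : ∀ i, A i o 0 = 1)
    (i m : ℕ) :
    (p : ℤ_[p][X]) ∣ PowerSeries.trunc (p ^ (m + 1)) (PowerSeries.mk (A i o))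
      - PowerSeries.trunc p (PowerSeries.mk (A i o))
        * PowerSeries.trunc (p ^ m) (PowerSeries.mk (A (i + 1) o)) ^ p := by
  refine (dvd_iff_dvd_of_dvd_sub (c := PowerSeries.trunc (p ^ (m + 1)) (PowerSeries.mk (A i o))
      - PowerSeries.trunc p (PowerSeries.mk (A i o))
        * Polynomial.expand _ p (PowerSeries.trunc (p ^ m) (PowerSeries.mk (A (i + 1) o)))) ?_).2 ?_
  · rw [sub_sub_sub_cancel_left, ← mul_sub]
    exact (natCast_dvd_expand_sub_pow _).mul_left _
  · simp only [trunc_mk_eq_sum, pow_succ', sum_range_mul_eq, map_sum, map_mul, map_pow,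
      Polynomial.expand_C, Polynomial.expand_X, Finset.sum_mul_sum, ← Finset.sum_sub_distrib]
    refine Finset.dvd_sum fun v hv => Finset.dvd_sum fun z _ => ?_
    have h := map_dvd (Polynomial.C : ℤ_[p] →+* ℤ_[p][X])
      (hA.dvd_sub_mul h1 i v z (Finset.mem_range.1 hv))
    simp only [map_natCast, map_sub, map_mul] at h
    convert h.mul_right (Polynomial.X ^ (v + p * z)) using 1
    rw [pow_add, pow_mul]; ring

theorem IsDworkSystem.dvd_trunc_sub_prod (hA : IsDworkSystem p o A) (h1 : ∀ i, A i o 0 = 1)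
    (m : ℕ) : ∀ i,
    (p : ℤ_[p][X]) ∣ PowerSeries.trunc (p ^ m) (PowerSeries.mk (A i o))
      - ∏ k ∈ Finset.range m, PowerSeries.trunc p (PowerSeries.mk (A (i + k) o)) ^ p ^ k := by
  induction m with
  | zero =>
    intro i
    simp [trunc_mk_eq_sum, h1]
  | succ m ih =>
    intro i
    rw [Finset.prod_range_succ']
    refine (dvd_iff_dvd_of_dvd_sub ?_).1 (hA.dvd_trunc_sub_mul_pow h1 i m)
    rw [sub_sub_sub_cancel_left, pow_zero, pow_one, add_zero, mul_comm, ← mul_sub]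
    refine Dvd.dvd.mul_left ?_ _
    have e : ∏ k ∈ Finset.range m, PowerSeries.trunc p (PowerSeries.mk (A (i + (k + 1)) o))
          ^ p ^ (k + 1)
        = (∏ k ∈ Finset.range m, PowerSeries.trunc p (PowerSeries.mk (A (i + 1 + k) o))
          ^ p ^ k) ^ p := by
      rw [← Finset.prod_pow]
      refine Finset.prod_congr rfl fun k _ => ?_
      rw [← pow_mul, ← pow_succ, add_assoc, add_comm 1 k]
    rw [e, ← neg_sub, dvd_neg]
    exact (ih (i + 1)).trans (sub_dvd_pow_sub_pow _ _ p)

end ModP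

noncomputable section

/-! ### Unit parts of Pochhammer symbols. -/

section Unit

variable {p : ℕ} [hp : Fact p.Prime]

theorem pow_dvd_iff_norm_le (x : ℤ_[p]) (n : ℕ) :
    (p : ℤ_[p]) ^ n ∣ x ↔ ‖x‖ ≤ (p : ℝ) ^ (-n : ℤ) := by
  rw [PadicInt.norm_le_pow_iff_mem_span_pow, Ideal.mem_span_singleton]

theorem not_isUnit_iff_dvd (x : ℤ_[p]) : ¬ IsUnit x ↔ (p : ℤ_[p]) ∣ x := by
  rw [PadicInt.isUnit_iff, ← PadicInt.norm_lt_one_iff_dvd]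
  exact ⟨fun h => lt_of_le_of_ne x.norm_le_one h, fun h => h.ne⟩

theorem natCast_dvd_natCast_iff (n : ℕ) : (p : ℤ_[p]) ∣ n ↔ p ∣ n := by
  rw [← PadicInt.norm_lt_one_iff_dvd]
  simp

theorem isUnit_natCast_iff (n : ℕ) : IsUnit (n : ℤ_[p]) ↔ ¬ p ∣ n := by
  rw [← natCast_dvd_natCast_iff, ← not_isUnit_iff_dvd, not_not]

theorem digitZero_lt (α : ℤ_[p]) : digitZero α < p := PadicInt.zmodRepr_lt_p _

theorem add_digitZero (α : ℤ_[p]) : α + digitZero α = p * dworkPrime α :=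
  (exists_dworkPrime α).choose_spec

theorem isUnit_add_iff (α : ℤ_[p]) (k : ℕ) : IsUnit (α + k) ↔ ¬ k ≡ digitZero α [MOD p] := by
  rw [← not_iff_not, not_not, not_isUnit_iff_dvd]
  have h : α + k = p * dworkPrime α - ((digitZero α : ℤ_[p]) - k) := by
    rw [← add_digitZero]; ring
  rw [h, dvd_sub_right (dvd_mul_right _ _), Nat.modEq_iff_dvd]
  have := PadicInt.norm_int_lt_one_iff_dvd (p := p) ((digitZero α : ℤ) - k)
  rw [PadicInt.norm_lt_one_iff_dvd] at this
  simpa using this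

/-- The unit `x` itself, or `1` when `x` is not a unit. -/
def unitPart (x : ℤ_[p]) : ℤ_[p]ˣ :=
  open Classical in if h : IsUnit x then h.unit else 1

theorem unitPart_of_isUnit {x : ℤ_[p]} (h : IsUnit x) : (unitPart x : ℤ_[p]) = x := by
  simp [unitPart, h]

theorem unitPart_of_not_isUnit {x : ℤ_[p]} (h : ¬ IsUnit x) : unitPart x = 1 := by
  simp [unitPart, h]

theorem isUnit_iff_of_dvd_sub {x y : ℤ_[p]} {i : ℕ} (hi : i ≠ 0) (h : (p : ℤ_[p]) ^ i ∣ x - y) :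
    IsUnit x ↔ IsUnit y := by
  rw [← not_iff_not, not_isUnit_iff_dvd, not_isUnit_iff_dvd]
  exact dvd_iff_dvd_of_dvd_sub ((dvd_pow_self _ hi).trans h)

theorem dvd_unitPart_sub {x y : ℤ_[p]} {i : ℕ} (hi : i ≠ 0) (h : (p : ℤ_[p]) ^ i ∣ x - y) :
    (p : ℤ_[p]) ^ i ∣ (unitPart x : ℤ_[p]) - unitPart y := by
  have hxy := isUnit_iff_of_dvd_sub hi h
  by_cases hx : IsUnit x
  · rwa [unitPart_of_isUnit hx, unitPart_of_isUnit (hxy.1 hx)]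
  · rw [unitPart_of_not_isUnit hx, unitPart_of_not_isUnit (mt hxy.2 hx), sub_self]
    exact dvd_zero _

theorem isLip_unitPart (α : ℤ_[p]) (v : ℕ) :
    IsLip p 1 fun z => (unitPart (α + ((v + p * z : ℕ) : ℤ_[p])) : ℤ_[p]) := fun k z z' h => by
  refine dvd_unitPart_sub k.succ_ne_zero ?_
  rw [add_sub_add_left_eq_sub]
  simpa using (isLip_cast (Q := ℤ_[p]) (p := p)).comp_digit v k z z' h

/-- The product of the unit parts of `α, α + 1, …, α + n - 1`. -/
def unitPoch (α : ℤ_[p]) (n : ℕ) : ℤ_[p]ˣ := ∏ k ∈ Finset.range n, unitPart (α + k)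

theorem unitPoch_add_one_mul (α : ℤ_[p]) (n : ℕ) :
    unitPoch (α + 1) n * unitPart α = unitPoch α n * unitPart (α + (n : ℤ_[p])) := by
  have h := Finset.prod_range_succ' (fun k : ℕ => unitPart (α + (k : ℤ_[p]))) n
  rw [Finset.prod_range_succ] at h
  simp only [unitPoch, h, Nat.cast_zero, add_zero, Nat.cast_add, Nat.cast_one]
  congr 1
  refine Finset.prod_congr rfl fun k _ => ?_
  rw [add_assoc, add_comm 1]

theorem dvd_unitPoch_sub {x y : ℤ_[p]} {i : ℕ} (hi : i ≠ 0) (h : (p : ℤ_[p]) ^ i ∣ x - y)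
    (n : ℕ) : (p : ℤ_[p]) ^ i ∣ (unitPoch x n : ℤ_[p]) - unitPoch y n := by
  induction n with
  | zero => simp [unitPoch]
  | succ n ih =>
    simp only [unitPoch, Finset.prod_range_succ, Units.val_mul] at ih ⊢
    exact dvd_mul_sub_mul ih (dvd_unitPart_sub hi (by simpa using h))

/-- The Pochhammer symbol in `ℤ_p`. -/
def zpoch (α : ℤ_[p]) (n : ℕ) : ℤ_[p] := ∏ k ∈ Finset.range n, (α + k)

theorem coe_zpoch (α : ℤ_[p]) (n : ℕ) : (zpoch α n : ℚ_[p]) = poch α n := by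
  induction n with
  | zero => simp [zpoch, poch]
  | succ n ih =>
    rw [zpoch, poch, Finset.prod_range_succ, Finset.prod_range_succ] at *
    simp [ih]

theorem zpoch_succ (α : ℤ_[p]) (n : ℕ) : zpoch α (n + 1) = zpoch α n * (α + n) :=
  Finset.prod_range_succ _ _

/-- Among at most `p` consecutive terms starting at `α + p z`, the only possible non-unit is the one
with `k = digitZero α`, and it equals `p (α' + z)`. -/
theorem prod_add_digit (α : ℤ_[p]) (z v : ℕ) (hv : v ≤ p) :
    ∏ k ∈ Finset.range v, (α + (p * z + k : ℕ))
      = (∏ k ∈ Finset.range v, (unitPart (α + ((p * z + k : ℕ) : ℤ_[p])) : ℤ_[p]))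
        * if digitZero α < v then p * (dworkPrime α + z) else 1 := by
  induction v with
  | zero => simp
  | succ v ih =>
    rw [Finset.prod_range_succ, Finset.prod_range_succ, ih (by omega)]
    have hmod : p * z + v ≡ digitZero α [MOD p] ↔ v = digitZero α := by
      constructor
      · intro h
        have h' : v ≡ digitZero α [MOD p] := by simpa [Nat.ModEq] using h
        exact h'.eq_of_lt_of_lt (by omega) (digitZero_lt α)
      · rintro rfl; simp [Nat.ModEq]
    by_cases hvd : v = digitZero α
    · have hu : ¬ IsUnit (α + (p * z + v : ℕ)) := by
        rw [isUnit_add_iff, not_not, hmod]; exact hvd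
      rw [unitPart_of_not_isUnit hu, if_neg (by omega), if_pos (by omega)]
      have h2 := add_digitZero α
      rw [← hvd] at h2
      have : α + (p * z + v : ℕ) = p * (dworkPrime α + z) := by
        push_cast; rw [mul_add, ← h2]; ring
      rw [this]; simp
    · have hu : IsUnit (α + (p * z + v : ℕ)) := by
        rw [isUnit_add_iff, hmod]; exact hvd
      rw [unitPart_of_isUnit hu]
      by_cases h : digitZero α < v
      · rw [if_pos h, if_pos (by omega)]; ring
      · rw [if_neg h, if_neg (by omega)]; ring

theorem zpoch_add (α : ℤ_[p]) (m n : ℕ) :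
    zpoch α (m + n) = zpoch α m * ∏ k ∈ Finset.range n, (α + (m + k : ℕ)) :=
  Finset.prod_range_add _ _ _

theorem unitPoch_add (α : ℤ_[p]) (m n : ℕ) :
    unitPoch α (m + n) = unitPoch α m * ∏ k ∈ Finset.range n, unitPart (α + ((m + k : ℕ) : ℤ_[p])) :=
  Finset.prod_range_add _ _ _

theorem zpoch_p_mul (α : ℤ_[p]) (z : ℕ) :
    zpoch α (p * z) = unitPoch α (p * z) * (p ^ z * zpoch (dworkPrime α) z) := by
  induction z with
  | zero => simp [zpoch, unitPoch]
  | succ z ih =>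
    rw [mul_add, mul_one, zpoch_add, ih, prod_add_digit α z p le_rfl, if_pos (digitZero_lt α),
      unitPoch_add, zpoch_succ, pow_succ]
    push_cast
    ring

theorem zpoch_digit (α : ℤ_[p]) (z v : ℕ) (hv : v < p) :
    zpoch α (v + p * z) = unitPoch α (v + p * z) * (p ^ z * zpoch (dworkPrime α) z)
      * if digitZero α < v then p * (dworkPrime α + z) else 1 := by
  rw [add_comm, zpoch_add, zpoch_p_mul, prod_add_digit α z v hv.le, unitPoch_add]
  push_cast
  ring

end Unit

/-! ### Functions of the form `1 + p l Φ(l)`. -/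

section Nice

/-- `f l = 1 + p l Φ(l)` with `Φ` Lipschitz; then `Φ 0` is the logarithmic derivative
of `f` at `0`, divided by `p`. -/
structure IsNice {R : Type*} [CommRing R] (p : ℕ) (f Φ : ℕ → R) : Prop where
  eq : ∀ l, f l = 1 + p * l * Φ l
  lip : IsLip p 0 Φ

variable {R : Type*} [CommRing R] {p : ℕ} {f g Φ Ψ : ℕ → R}

theorem IsNice.isLip (hf : IsNice p f Φ) : IsLip p 1 f := by
  have : f = fun l => 1 + p * (l * Φ l) := by funext l; rw [hf.eq]; ring
  rw [this]
  exact (IsLip.const p 1 1).add (isLip_cast.mul hf.lip).p_mul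

theorem IsNice.mul (hf : IsNice p f Φ) (hg : IsNice p g Ψ) :
    IsNice p (fun l => f l * g l) fun l => Φ l * g l + Ψ l where
  eq l := by rw [hf.eq, hg.eq]; ring
  lip := (hf.lip.mul (hg.isLip.mono zero_le_one)).add hg.lip

theorem IsNice.inv {u : ℕ → Rˣ} (hu : IsNice p (fun l => (u l : R)) Φ) :
    IsNice p (fun l => ((u l)⁻¹ : Rˣ).val) fun l => - (Φ l * ((u l)⁻¹ : Rˣ).val) where
  eq l := by
    have h1 := (u l).mul_inv
    have h2 := hu.eq l
    linear_combination h1 - ((u l)⁻¹ : Rˣ).val * h2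
  lip := (hu.lip.mul (hu.isLip.inv.mono zero_le_one)).neg

theorem IsNice.one : IsNice p (fun _ => (1 : R)) fun _ => 0 := ⟨by simp, IsLip.const _ _ _⟩

theorem IsNice.map {R' : Type*} [CommRing R'] (φ : R →+* R') (hf : IsNice p f Φ) :
    IsNice p (fun l => φ (f l)) fun l => φ (Φ l) :=
  ⟨fun l => by simp [hf.eq], hf.lip.map φ⟩

theorem IsNice.apply_zero (hf : IsNice p f Φ) : f 0 = 1 := by simp [hf.eq]

theorem exists_isNice_prod {ι : Type*} (s : Finset ι) {f Φ : ι → ℕ → R}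
    (h : ∀ i ∈ s, IsNice p (f i) (Φ i)) :
    ∃ Ψ : ℕ → R, IsNice p (fun l => ∏ i ∈ s, f i l) Ψ ∧ Ψ 0 = ∑ i ∈ s, Φ i 0 := by
  classical
  induction s using Finset.induction_on with
  | empty => exact ⟨_, by simpa using IsNice.one, rfl⟩
  | insert i s hi ih =>
    obtain ⟨Ψ, hΨ, h0⟩ := ih fun j hj => h j (Finset.mem_insert_of_mem hj)
    have hi' := h i (Finset.mem_insert_self i s)
    refine ⟨_, by simpa only [Finset.prod_insert hi] using hi'.mul hΨ, ?_⟩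
    simp only [hΨ.apply_zero, mul_one, h0, Finset.sum_insert hi]

end Nice

/-! ### Digamma values as derivatives of unit ratios, at positive integers. -/

section Digamma

variable {p : ℕ} [hp : Fact p.Prime]

/-- The ratio `∏ unitPart (α + k) / ∏ unitPart (1 + k)`, the products being over `k < p h`. -/
def unitRatio (α : ℤ_[p]) (h : ℕ) : ℤ_[p]ˣ := unitPoch α (p * h) * (unitPoch 1 (p * h))⁻¹

/-- The harmonic sums `∑_{1 ≤ k < n, p ∤ k} 1 / k`. -/
def harmonicSum (p : ℕ) [Fact p.Prime] (n : ℕ) : ℚ_[p] :=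
  ∑ k ∈ (Finset.Ico 1 n).filter (fun k => ¬ p ∣ k), ((k : ℚ_[p]))⁻¹

theorem harmonicSum_succ (n : ℕ) (hn : 1 ≤ n) :
    harmonicSum p (n + 1) = harmonicSum p n + if p ∣ n then 0 else ((n : ℚ_[p]))⁻¹ := by
  simp only [harmonicSum, Finset.sum_filter]
  rw [Finset.sum_Ico_succ_top hn]
  simp [ite_not]

theorem coe_units_inv (u : ℤ_[p]ˣ) : (((u⁻¹ : ℤ_[p]ˣ) : ℤ_[p]) : ℚ_[p]) = ((u : ℤ_[p]) : ℚ_[p])⁻¹ := by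
  refine eq_inv_of_mul_eq_one_left ?_
  rw [← PadicInt.coe_mul, Units.inv_mul, PadicInt.coe_one]

/-- Telescoping in `n`: passing to `n + 1` multiplies the ratio by `(n + p h) / n = 1 + p h / n` if
`p ∤ n`, and by `1` otherwise. At `h = 0` this adds the next term of the harmonic sum. -/
theorem exists_isNice_unitRatio_natCast (n : ℕ) (hn : 1 ≤ n) :
    ∃ Φ : ℕ → ℤ_[p], IsNice p (fun h => (unitRatio (n : ℤ_[p]) h : ℤ_[p])) Φ ∧
      (Φ 0 : ℚ_[p]) = harmonicSum p n := by
  induction n, hn using Nat.le_induction with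
  | base =>
    refine ⟨fun _ => 0, ?_, by simp [harmonicSum]⟩
    simpa [unitRatio] using IsNice.one (R := ℤ_[p]) (p := p)
  | succ n hn ih =>
    obtain ⟨Φ, hΦ, h0⟩ := ih
    have hrec : ∀ h, (unitRatio ((n + 1 : ℕ) : ℤ_[p]) h : ℤ_[p])
        = unitRatio (n : ℤ_[p]) h
          * (unitPart ((n : ℤ_[p]) + ((p * h : ℕ) : ℤ_[p])) * (unitPart (n : ℤ_[p]))⁻¹ : ℤ_[p]ˣ) := by
      intro h
      rw [← Units.val_mul, Units.val_inj, unitRatio, unitRatio, Nat.cast_add, Nat.cast_one,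
        eq_mul_inv_of_mul_eq (unitPoch_add_one_mul (n : ℤ_[p]) (p * h))]
      simp only [mul_assoc, mul_comm, mul_left_comm]
    have hlast : ∃ c : ℤ_[p], IsNice p (fun h =>
        ((unitPart ((n : ℤ_[p]) + ((p * h : ℕ) : ℤ_[p])) * (unitPart (n : ℤ_[p]))⁻¹ : ℤ_[p]ˣ) : ℤ_[p]))
        (fun _ => c) ∧ (c : ℚ_[p]) = if p ∣ n then 0 else ((n : ℚ_[p]))⁻¹ := by
      by_cases hpn : p ∣ n
      · refine ⟨0, ⟨fun h => ?_, IsLip.const _ _ _⟩, by simp [hpn]⟩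
        have h1 : ¬ IsUnit (n : ℤ_[p]) := by rw [isUnit_natCast_iff, not_not]; exact hpn
        have h2 : ¬ IsUnit ((n : ℤ_[p]) + (p * h : ℕ)) := by
          rw [← Nat.cast_add, isUnit_natCast_iff, not_not]
          exact dvd_add hpn (dvd_mul_right _ _)
        rw [unitPart_of_not_isUnit h1, unitPart_of_not_isUnit h2]
        simp
      · have h1 : IsUnit (n : ℤ_[p]) := by rw [isUnit_natCast_iff]; exact hpn
        refine ⟨((unitPart (n : ℤ_[p]))⁻¹ : ℤ_[p]ˣ), ⟨fun h => ?_, IsLip.const _ _ _⟩, ?_⟩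
        · have h2 : IsUnit ((n : ℤ_[p]) + (p * h : ℕ)) := by
            rw [← Nat.cast_add, isUnit_natCast_iff, Nat.dvd_add_left (dvd_mul_right _ _)]
            exact hpn
          have h3 := (unitPart (n : ℤ_[p])).mul_inv
          rw [Units.val_mul, unitPart_of_isUnit h2]
          rw [unitPart_of_isUnit h1] at h3
          push_cast
          linear_combination h3
        · rw [coe_units_inv, unitPart_of_isUnit h1, if_neg hpn]; simp
    obtain ⟨c, hc, hc0⟩ := hlast
    refine ⟨_, by simpa only [hrec] using hΦ.mul hc, ?_⟩
    simp only [hc.apply_zero, mul_one, PadicInt.coe_add, h0, hc0, harmonicSum_succ n hn]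

theorem dvd_unitRatio_sub {x y : ℤ_[p]} {i : ℕ} (hi : i ≠ 0) (h : (p : ℤ_[p]) ^ i ∣ x - y)
    (n : ℕ) : (p : ℤ_[p]) ^ i ∣ (unitRatio x n : ℤ_[p]) - unitRatio y n := by
  simp only [unitRatio, Units.val_mul, ← sub_mul]
  exact (dvd_unitPoch_sub hi h _).mul_right _

theorem exists_natCast_near (α : ℤ_[p]) (i : ℕ) : ∃ n : ℕ, 1 ≤ n ∧ (p : ℤ_[p]) ^ i ∣ n - α := by
  -- The summand `p^i` only serves to make the approximation positive.
  refine ⟨α.appr i + p ^ i, (Nat.one_le_pow _ _ hp.out.pos).trans (Nat.le_add_left _ _), ?_⟩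
  have h := PadicInt.appr_spec i α
  rw [Ideal.mem_span_singleton] at h
  push_cast
  have : (α.appr i : ℤ_[p]) + p ^ i - α = p ^ i - (α - α.appr i) := by ring
  rw [this]
  exact dvd_sub dvd_rfl h

/-- The nice function attached to a natural number `n`; see `exists_isNice_unitRatio_natCast`. -/
def natLog (p : ℕ) [Fact p.Prime] (n : ℕ) : ℕ → ℤ_[p] :=
  if hn : 1 ≤ n then (exists_isNice_unitRatio_natCast n hn).choose else fun _ => 0

theorem isNice_natLog {n : ℕ} (hn : 1 ≤ n) :
    IsNice p (fun h => (unitRatio (n : ℤ_[p]) h : ℤ_[p])) (natLog p n) := by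
  rw [natLog, dif_pos hn]; exact (exists_isNice_unitRatio_natCast n hn).choose_spec.1

theorem natLog_zero {n : ℕ} (hn : 1 ≤ n) : (natLog p n 0 : ℚ_[p]) = harmonicSum p n := by
  rw [natLog, dif_pos hn]; exact (exists_isNice_unitRatio_natCast n hn).choose_spec.2

theorem p_ne_zero : (p : ℤ_[p]) ≠ 0 := by exact_mod_cast hp.out.ne_zero

/-- The value at `0` is not visible in the ratio, so compare at `h = p^j`, which changes each value
only by a multiple of `p^j`. There the ratios agree mod `p^(2j+1)`, and dividing by `p h = p^(j+1)`
leaves `p^j`. -/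
theorem dvd_natLog_zero_sub {n n' j : ℕ} (hn : 1 ≤ n) (hn' : 1 ≤ n')
    (h : (p : ℤ_[p]) ^ (2 * j + 1) ∣ n - n') :
    (p : ℤ_[p]) ^ j ∣ natLog p n 0 - natLog p n' 0 := by
  have h1 := (isNice_natLog (p := p) hn).lip j (p ^ j) 0 (by simp [Nat.ModEq])
  have h2 := (isNice_natLog (p := p) hn').lip j (p ^ j) 0 (by simp [Nat.ModEq])
  have h3 := dvd_unitRatio_sub (by omega) h (p ^ j)
  have e1 := (isNice_natLog (p := p) hn).eq (p ^ j)
  have e2 := (isNice_natLog (p := p) hn').eq (p ^ j)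
  rw [e1, e2, show 2 * j + 1 = (j + 1) + j by ring, pow_add] at h3
  have e3 : (1 + (p : ℤ_[p]) * (p ^ j : ℕ) * natLog p n (p ^ j))
      - (1 + (p : ℤ_[p]) * (p ^ j : ℕ) * natLog p n' (p ^ j))
      = p ^ (j + 1) * (natLog p n (p ^ j) - natLog p n' (p ^ j)) := by push_cast; ring
  rw [e3, mul_dvd_mul_iff_left (pow_ne_zero _ p_ne_zero)] at h3
  have : natLog p n 0 - natLog p n' 0 = (natLog p n (p ^ j) - natLog p n' (p ^ j))
    - (natLog p n (p ^ j) - natLog p n 0) + (natLog p n' (p ^ j) - natLog p n' 0) := by ring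
  rw [this]
  exact dvd_add (dvd_sub h3 h1) h2

end Digamma

/-! ### Passage to the limit from integers to `ℤ_p`. -/

section DigammaLimit

variable {p : ℕ} [hp : Fact p.Prime]

/-- The filter of positive integers tending `p`-adically to `α`. -/
def natNhds (α : ℤ_[p]) : Filter ℕ :=
  comap (fun n : ℕ => (n : ℤ_[p])) (𝓝 α) ⊓ 𝓟 {n : ℕ | 0 < n}

theorem exists_pow_le {ε : ℝ} (hε : 0 < ε) : ∃ i : ℕ, (p : ℝ) ^ (-(i : ℤ)) < ε := by
  have h1 : ((p : ℝ)⁻¹) < 1 := inv_lt_one_of_one_lt₀ (by exact_mod_cast hp.out.one_lt)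
  obtain ⟨i, hi⟩ := exists_pow_lt_of_lt_one hε h1
  exact ⟨i, by rwa [zpow_neg, zpow_natCast, ← inv_pow]⟩

theorem pow_neg_pos (i : ℕ) : 0 < (p : ℝ) ^ (-(i : ℤ)) :=
  zpow_pos (by exact_mod_cast hp.out.pos) _

theorem eventually_natNhds (α : ℤ_[p]) (i : ℕ) :
    ∀ᶠ n : ℕ in natNhds α, 1 ≤ n ∧ (p : ℤ_[p]) ^ i ∣ (n : ℤ_[p]) - α := by
  refine Filter.inter_mem (mem_inf_of_right (mem_principal_self _)) (mem_inf_of_left ?_)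
  refine ⟨Metric.closedBall α ((p : ℝ) ^ (-(i : ℤ))),
    Metric.closedBall_mem_nhds _ (pow_neg_pos i), fun n hn => ?_⟩
  simp only [Set.mem_preimage, Metric.mem_closedBall, dist_eq_norm] at hn
  exact (pow_dvd_iff_norm_le _ _).2 hn

instance natNhds_neBot (α : ℤ_[p]) : (natNhds α).NeBot := by
  rw [natNhds, Filter.inf_principal_neBot_iff]
  rintro U ⟨V, hV, hVU⟩
  obtain ⟨ε, hε, hεV⟩ := Metric.mem_nhds_iff.1 hV
  obtain ⟨i, hi⟩ := exists_pow_le (p := p) hε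
  obtain ⟨n, hn, hni⟩ := exists_natCast_near α i
  refine ⟨n, hVU (hεV ?_), hn⟩
  rw [Metric.mem_ball, dist_eq_norm]
  exact ((pow_dvd_iff_norm_le _ _).1 hni).trans_lt hi

theorem tendsto_harmonicSum (α : ℤ_[p]) :
    Tendsto (harmonicSum p) (natNhds α) (𝓝 (psiTilde α)) := by
  have hc : Cauchy (map (harmonicSum p) (natNhds α)) := by
    rw [Metric.cauchy_iff]
    refine ⟨inferInstance, fun ε hε => ?_⟩
    obtain ⟨j, hj⟩ := exists_pow_le (p := p) hε
    refine ⟨harmonicSum p '' {n : ℕ | 1 ≤ n ∧ (p : ℤ_[p]) ^ (2 * j + 1) ∣ (n : ℤ_[p]) - α},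
      image_mem_map (eventually_natNhds α (2 * j + 1)), ?_⟩
    rintro _ ⟨n, ⟨hn, hnα⟩, rfl⟩ _ ⟨n', ⟨hn', hnα'⟩, rfl⟩
    rw [dist_eq_norm, ← natLog_zero hn, ← natLog_zero hn', ← PadicInt.coe_sub]
    refine lt_of_le_of_lt ?_ hj
    rw [← PadicInt.norm_def, ← pow_dvd_iff_norm_le]
    refine dvd_natLog_zero_sub hn hn' ?_
    rw [← sub_sub_sub_cancel_right _ _ α]
    exact dvd_sub hnα hnα'
  exact tendsto_nhds_limUnder (CompleteSpace.complete hc)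

theorem norm_psiTilde_sub_le {α : ℤ_[p]} {n j : ℕ} (hn : 1 ≤ n)
    (h : (p : ℤ_[p]) ^ (2 * j + 1) ∣ n - α) :
    ‖psiTilde α - natLog p n 0‖ ≤ (p : ℝ) ^ (-(j : ℤ)) := by
  refine le_of_tendsto ((tendsto_harmonicSum α).sub_const _).norm ?_
  filter_upwards [eventually_natNhds α (2 * j + 1)] with n' hn'
  rw [← natLog_zero hn'.1, ← PadicInt.coe_sub, ← PadicInt.norm_def, ← pow_dvd_iff_norm_le]
  refine dvd_natLog_zero_sub hn'.1 hn ?_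
  rw [← sub_sub_sub_cancel_right _ _ α]
  exact dvd_sub hn'.2 h

theorem exists_psiTilde_eq (α : ℤ_[p]) : ∃ y : ℤ_[p], (y : ℚ_[p]) = psiTilde α := by
  obtain ⟨n, hn, h⟩ := exists_natCast_near α (2 * 0 + 1)
  have h1 := norm_psiTilde_sub_le hn h
  have h2 : ‖psiTilde α‖ ≤ 1 := by
    rw [← sub_add_cancel (psiTilde α) (natLog p n 0)]
    refine (Padic.nonarchimedean _ _).trans (max_le (by simpa using h1) ?_)
    exact (natLog p n 0).2
  exact ⟨⟨_, h2⟩, rfl⟩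

/-- For `h` fixed, `natLog p n h` converges as `n → α`. -/
theorem exists_natLog_limit (α : ℤ_[p]) (h : ℕ) :
    ∃ y : ℤ_[p], (h = 0 → (y : ℚ_[p]) = psiTilde α) ∧
      (unitRatio α h : ℤ_[p]) = 1 + p * h * y ∧
      ∀ k : ℕ, ∃ i : ℕ, ∀ n : ℕ, 1 ≤ n → (p : ℤ_[p]) ^ i ∣ n - α →
        (p : ℤ_[p]) ^ k ∣ y - natLog p n h := by
  rcases Nat.eq_zero_or_pos h with rfl | hh
  · obtain ⟨y, hy⟩ := exists_psiTilde_eq α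
    refine ⟨y, fun _ => hy, by simp [unitRatio, unitPoch], fun k => ⟨2 * k + 1, fun n hn hd => ?_⟩⟩
    rw [pow_dvd_iff_norm_le, PadicInt.norm_def, PadicInt.coe_sub, hy]
    exact norm_psiTilde_sub_le hn hd
  · have hne : (p * h : ℤ_[p]) ≠ 0 := mul_ne_zero p_ne_zero (by exact_mod_cast hh.ne')
    obtain ⟨s, u, hsu⟩ : ∃ (s : ℕ) (u : ℤ_[p]ˣ), (p * h : ℤ_[p]) = u * p ^ s :=
      ⟨_, _, PadicInt.unitCoeff_spec hne⟩
    have hs : ((p * h : ℤ_[p])) ∣ p ^ s := by rw [hsu]; simp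
    have hs0 : s ≠ 0 := by
      rintro rfl
      rw [pow_zero, mul_one] at hsu
      exact (not_isUnit_iff_dvd (p * h : ℤ_[p])).2 (dvd_mul_right _ _) (hsu ▸ u.isUnit)
    have hdiff : ∀ i n : ℕ, 1 ≤ n → (p : ℤ_[p]) ^ (i + s) ∣ n - α →
        (p : ℤ_[p]) ^ (i + s) ∣ (unitRatio α h : ℤ_[p]) - (1 + p * h * natLog p n h) := by
      intro i n hn hd
      rw [← (isNice_natLog hn).eq h]
      refine dvd_unitRatio_sub (by omega) ?_ h
      rw [← neg_sub, dvd_neg]; exact hd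
    -- Since `p h` is a unit times `p^s`, approximating `α` to `s` digits suffices to see that `p h`
    -- divides `unitRatio α h - 1`.
    obtain ⟨n, hn, hd⟩ := exists_natCast_near α (0 + s)
    have h1 := hdiff 0 n hn hd
    rw [zero_add] at h1
    obtain ⟨y, hy⟩ : (p * h : ℤ_[p]) ∣ unitRatio α h - 1 := by
      have := dvd_add (hs.trans h1) (dvd_mul_right (p * h : ℤ_[p]) (natLog p n h))
      convert this using 1; ring
    refine ⟨y, fun h0 => absurd h0 hh.ne', by rw [← hy]; ring, fun k => ⟨k + s, fun n hn hd => ?_⟩⟩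
    have h2 := hdiff k n hn hd
    have e : (unitRatio α h : ℤ_[p]) - (1 + p * h * natLog p n h)
        = p * h * (y - natLog p n h) := by linear_combination hy
    rw [e, hsu, mul_assoc, Units.dvd_mul_left, mul_comm (_ ^ s), pow_add,
      mul_dvd_mul_iff_right (pow_ne_zero _ p_ne_zero)] at h2
    exact h2

/-- The Lipschitz bounds for integers `n` do not depend on `n`, so they survive as `n → α`. -/
theorem exists_isNice_unitRatio (α : ℤ_[p]) :
    ∃ Φ : ℕ → ℤ_[p], IsNice p (fun h => (unitRatio α h : ℤ_[p])) Φ ∧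
      (Φ 0 : ℚ_[p]) = psiTilde α := by
  choose Φ h0 h1 h2 using exists_natLog_limit α
  refine ⟨Φ, ⟨h1, fun k z z' hzz => ?_⟩, h0 0 rfl⟩
  obtain ⟨i, hi⟩ := h2 z k
  obtain ⟨i', hi'⟩ := h2 z' k
  obtain ⟨n, hn, hd⟩ := exists_natCast_near α (max i i')
  have d1 := hi n hn ((pow_dvd_pow _ (le_max_left _ _)).trans hd)
  have d2 := hi' n hn ((pow_dvd_pow _ (le_max_right _ _)).trans hd)
  have d3 := (isNice_natLog (p := p) hn).lip k z z' hzz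
  have e : Φ z - Φ z' = (Φ z - natLog p n z) + (natLog p n z - natLog p n z')
    - (Φ z' - natLog p n z') := by ring
  rw [e]
  exact dvd_sub (dvd_add d1 d3) d2

end DigammaLimit

/-! ### Dwork primes. -/

section Iterates

variable {p : ℕ} [hp : Fact p.Prime]

theorem dworkIter_succ (n : ℕ) (α : ℤ_[p]) :
    dworkIter (n + 1) α = dworkPrime (dworkIter n α) :=
  Function.iterate_succ_apply' _ _ _

theorem digitZero_one : digitZero (1 : ℤ_[p]) = p - 1 := by
  have h : ¬ IsUnit ((1 : ℤ_[p]) + ((p - 1 : ℕ) : ℤ_[p])) := by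
    rw [not_isUnit_iff_dvd, Nat.cast_sub hp.out.one_le]
    simp
  rw [isUnit_add_iff, not_not] at h
  exact (h.eq_of_lt_of_lt (Nat.sub_lt hp.out.pos one_pos) (digitZero_lt _)).symm

theorem dworkPrime_one : dworkPrime (1 : ℤ_[p]) = 1 := by
  have h := add_digitZero (1 : ℤ_[p])
  rw [digitZero_one, Nat.cast_sub hp.out.one_le] at h
  refine mul_left_cancel₀ (p_ne_zero (p := p)) ?_
  rw [← h]; simp

theorem dworkIter_one (n : ℕ) : dworkIter n (1 : ℤ_[p]) = 1 :=
  Function.iterate_fixed dworkPrime_one n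

theorem dworkIter_add_natCast_ne_zero {α : ℤ_[p]} (hα : ∀ m : ℕ, α ≠ -(m : ℤ_[p])) (n : ℕ) :
    ∀ m : ℕ, dworkIter n α + m ≠ 0 := by
  induction n with
  | zero => exact fun m h => hα m (eq_neg_of_add_eq_zero_left h)
  | succ n ih =>
    intro m h
    rw [dworkIter_succ] at h
    refine ih (digitZero (dworkIter n α) + p * m) ?_
    push_cast
    rw [← add_assoc, add_digitZero, ← mul_add, h, mul_zero]

end Iterates

/-! ### The digit condition as an inequality between cardinalities. -/

section Counting

/-- If `s` of the selected values of `g` are at most `v`, then the `s`-th smallest value of `g` is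
at most `v`. The interlacing puts the `(s+1)`-st smallest value of `f` strictly below it. -/
theorem card_add_one_le_card {s r : ℕ} {f : Fin (r + 1) → ℕ} {g : Fin r → ℕ} {Q : Fin r → Prop}
    [DecidablePred Q]
    (h : ∀ (ρ : Equiv.Perm (Fin (r + 1))) (τ : Equiv.Perm (Fin r)),
      Monotone (fun i => f (ρ i)) → Monotone (fun j => g (τ j)) →
      ∀ j : Fin r, (j : ℕ) < Nat.card {k : Fin r // Q k} → f (ρ j.succ) < g (τ j))
    {v : ℕ} (hs : s ≠ 0) (hJ : s ≤ (Finset.univ.filter fun j => Q j ∧ g j ≤ v).card) :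
    s + 1 ≤ (Finset.univ.filter fun i => f i < v).card := by
  set ρ := Tuple.sort f
  set τ := Tuple.sort g
  have hρ : Monotone fun i => f (ρ i) := Tuple.monotone_sort f
  have hτ : Monotone fun j => g (τ j) := Tuple.monotone_sort g
  have hQ : s ≤ Nat.card {k : Fin r // Q k} := by
    rw [Nat.card_eq_fintype_card, Fintype.card_subtype]
    exact hJ.trans (Finset.card_le_card fun j hj => by simp at hj ⊢; exact hj.1)
  have hsr : s ≤ r := hJ.trans ((Finset.card_le_univ _).trans (by simp))
  -- Indices start at `0`: `j` is the `s`-th position of `g`, and `j.succ` the `(s+1)`-st of `f`.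
  let j : Fin r := ⟨s - 1, by omega⟩
  have hlt := h ρ τ hρ hτ j (by simp only [j]; omega)
  have hgv : g (τ j) ≤ v := by
    by_contra hcon
    have hsub : (Finset.univ.filter fun j => Q j ∧ g j ≤ v) ⊆ (Finset.Iio j).map τ.toEmbedding := by
      intro k hk
      simp only [Finset.mem_filter, Finset.mem_univ, true_and] at hk
      refine Finset.mem_map.2 ⟨τ.symm k, ?_, by simp⟩
      rw [Finset.mem_Iio]
      by_contra hle
      have := hτ (not_lt.1 hle)
      simp only [Equiv.apply_symm_apply] at this
      omega
    have := Finset.card_le_card hsub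
    rw [Finset.card_map, Fin.card_Iio] at this
    simp only [j] at this
    omega
  have hsub : (Finset.Iic j.succ).map ρ.toEmbedding ⊆ Finset.univ.filter fun i => f i < v := by
    intro k hk
    obtain ⟨i, hi, rfl⟩ := Finset.mem_map.1 hk
    have := hρ (Finset.mem_Iic.1 hi)
    simp only [Finset.mem_filter, Finset.mem_univ, true_and, Equiv.coe_toEmbedding] at this ⊢
    omega
  have := Finset.card_le_card hsub
  rw [Finset.card_map, Fin.card_Iic] at this
  simp only [j, Fin.val_succ] at this
  omega

end Counting

/-! ### Hypergeometric coefficients as a Dwork system. -/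

section System

variable {p : ℕ} [hp : Fact p.Prime] {r : ℕ} {a : Fin (r + 1) → ℤ_[p]} {b : Fin r → ℤ_[p]}

theorem coe_ne_zero {x : ℤ_[p]} (h : x ≠ 0) : (x : ℚ_[p]) ≠ 0 := fun e =>
  h (PadicInt.ext (by rw [e, PadicInt.coe_zero]))

theorem Admissible.add_ne_zero (hab : Admissible a b) (n : ℕ) (j : Fin r) (m : ℕ) :
    dworkIter n (b j) + m ≠ 0 :=
  dworkIter_add_natCast_ne_zero (hab.b_ne j) n m

theorem Admissible.card_le (hab : Admissible a b) (n v : ℕ) (S : Finset (Fin r)) (hS : S.Nonempty)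
    (hSv : ∀ j ∈ S, b j ≠ 1 ∧ digit n (b j) ≤ v) :
    S.card + 1 ≤ (Finset.univ.filter fun i => digit n (a i) < v).card := by
  classical
  refine card_add_one_le_card (Q := fun k => b k ≠ 1) (g := fun j => digit n (b j)) (hab.digits n)
     (Finset.card_ne_zero.2 hS) (Finset.card_le_card ?_)
  exact fun j hj => by simpa using hSv j hj

/-- The set of states: sets of indices `j` with `b_j ≠ 1`. -/
abbrev State (b : Fin r → ℤ_[p]) : Type := {S : Finset (Fin r) // ∀ j ∈ S, b j ≠ 1}

/-- The state `∅`. -/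
def State.empty (b : Fin r → ℤ_[p]) : State b := ⟨∅, by simp⟩

/-- The numerator of the hypergeometric coefficients. -/
def hypNum (a : Fin (r + 1) → ℤ_[p]) (z : ℕ) : ℤ_[p] := ∏ i, zpoch (a i) z

/-- The denominator of the hypergeometric coefficients. -/
def hypDen (b : Fin r → ℤ_[p]) (z : ℕ) : ℤ_[p] := (∏ j, zpoch (b j) z) * zpoch 1 z

/-- The hypergeometric coefficients at level `n`, divided by `∏_{j ∈ S} (b_j + z)`. -/
def stateCoeff (a : Fin (r + 1) → ℤ_[p]) (b : Fin r → ℤ_[p]) (n : ℕ) (S : State b) (z : ℕ) :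
    ℚ_[p] :=
  (hypNum (fun i => dworkIter n (a i)) z : ℚ_[p]) /
    ((hypDen (fun j => dworkIter n (b j)) z * ∏ j ∈ S.1, (dworkIter n (b j) + z) : ℤ_[p]) : ℚ_[p])

/-- The product of unit parts over an incomplete block. -/
def unitTail (α : ℤ_[p]) (v z : ℕ) : ℤ_[p]ˣ :=
  ∏ k ∈ Finset.range v, unitPart (α + ((k + p * z : ℕ) : ℤ_[p]))

theorem isLip_unitTail (α : ℤ_[p]) (v : ℕ) : IsLip p 1 fun z => (unitTail α v z : ℤ_[p]) := by
  simp only [unitTail, Units.coe_prod]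
  exact IsLip.prod _ fun k _ => isLip_unitPart α k

theorem isLip_unitRatio (α : ℤ_[p]) : IsLip p 1 fun z => (unitRatio α z : ℤ_[p]) := by
  obtain ⟨Φ, hΦ, -⟩ := exists_isNice_unitRatio α
  exact hΦ.isLip

theorem unitPoch_digit (α : ℤ_[p]) (v z : ℕ) :
    unitPoch α (v + p * z) = unitPoch 1 (p * z) * (unitRatio α z * unitTail α v z) := by
  rw [add_comm, unitPoch_add, unitRatio, unitTail]
  simp_rw [add_comm (p * z)]
  rw [← mul_assoc, mul_comm (unitPoch 1 _), inv_mul_cancel_right]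

theorem zpoch_ne_zero {α : ℤ_[p]} (h : ∀ m : ℕ, α + m ≠ 0) (z : ℕ) : zpoch α z ≠ 0 :=
  Finset.prod_ne_zero_iff.2 fun k _ => h k

theorem one_add_natCast_ne_zero (m : ℕ) : (1 : ℤ_[p]) + m ≠ 0 := by
  rw [add_comm]; exact Nat.cast_add_one_ne_zero m

theorem hypDen_ne_zero {b : Fin r → ℤ_[p]} (h : ∀ j, ∀ m : ℕ, b j + m ≠ 0) (z : ℕ) :
    hypDen b z ≠ 0 :=
  mul_ne_zero (Finset.prod_ne_zero_iff.2 fun j _ => zpoch_ne_zero (h j) z)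
    (zpoch_ne_zero one_add_natCast_ne_zero z)

theorem prod_zpoch_digit {ι : Type*} [Fintype ι] (α : ι → ℤ_[p]) (z v : ℕ) (hv : v < p) :
    ∏ i, zpoch (α i) (v + p * z)
      = (unitPoch (1 : ℤ_[p]) (p * z) : ℤ_[p]) ^ Fintype.card ι
        * (∏ i, (unitRatio (α i) z * unitTail (α i) v z : ℤ_[p]ˣ) : ℤ_[p]ˣ)
        * (p ^ z) ^ Fintype.card ι * (∏ i, zpoch (dworkPrime (α i)) z)
        * (p ^ (Finset.univ.filter fun i => digitZero (α i) < v).card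
          * ∏ i ∈ Finset.univ.filter fun i => digitZero (α i) < v, (dworkPrime (α i) + z)) := by
  simp only [zpoch_digit _ z v hv, unitPoch_digit, Units.val_mul, Finset.prod_mul_distrib,
    Units.coe_prod, Finset.prod_const, Finset.card_univ, ← Finset.prod_filter]
  ring

theorem hypDen_digit (b : Fin r → ℤ_[p]) (z v : ℕ) (hv : v < p) :
    hypDen b (v + p * z)
      = (unitPoch (1 : ℤ_[p]) (p * z) : ℤ_[p]) ^ (r + 1)
        * ((∏ j, (unitRatio (b j) z * unitTail (b j) v z : ℤ_[p]ˣ)) * unitTail 1 v z : ℤ_[p]ˣ)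
        * (p ^ z) ^ (r + 1) * hypDen (fun j => dworkPrime (b j)) z
        * (p ^ (Finset.univ.filter fun j => digitZero (b j) < v).card
          * ∏ j ∈ Finset.univ.filter fun j => digitZero (b j) < v, (dworkPrime (b j) + z)) := by
  have h1 : unitRatio (1 : ℤ_[p]) z = 1 := by simp [unitRatio]
  rw [hypDen, hypDen, prod_zpoch_digit b z v hv, zpoch_digit 1 z v hv, digitZero_one,
    if_neg (by omega), dworkPrime_one, unitPoch_digit, h1, Fintype.card_fin]
  simp only [Units.val_mul, Units.val_one]
  ring

theorem prod_add_digit_state (b : Fin r → ℤ_[p]) (S : Finset (Fin r)) (z v : ℕ) (hv : v < p) :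
    ∏ j ∈ S, (b j + (v + p * z : ℕ))
      = (∏ j ∈ S, unitPart (b j + ((v + p * z : ℕ) : ℤ_[p])) : ℤ_[p]ˣ)
        * (p ^ (S.filter fun j => digitZero (b j) = v).card
          * ∏ j ∈ S.filter fun j => digitZero (b j) = v, (dworkPrime (b j) + z)) := by
  rw [← Finset.prod_const, ← Finset.prod_mul_distrib, Finset.prod_filter, Units.coe_prod,
    ← Finset.prod_mul_distrib]
  refine Finset.prod_congr rfl fun j _ => ?_
  have hmod : v + p * z ≡ digitZero (b j) [MOD p] ↔ digitZero (b j) = v := by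
    constructor
    · intro h
      have h' : v ≡ digitZero (b j) [MOD p] := by simpa [Nat.ModEq] using h
      exact (h'.eq_of_lt_of_lt hv (digitZero_lt _)).symm
    · rintro rfl; simp [Nat.ModEq]
  by_cases h : digitZero (b j) = v
  · have hu : ¬ IsUnit (b j + (v + p * z : ℕ)) := by rw [isUnit_add_iff, not_not, hmod]; exact h
    rw [if_pos h, unitPart_of_not_isUnit hu, Units.val_one, one_mul, mul_add, ← add_digitZero, h]
    push_cast; ring
  · have hu : IsUnit (b j + (v + p * z : ℕ)) := by rw [isUnit_add_iff, hmod]; exact h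
    rw [if_neg h, unitPart_of_isUnit hu, mul_one]

/-- Each `a_i` with digit below `v` puts `p (a_i' + z)` in the numerator. Each `b_j` with digit
below `v`, and each `j ∈ S` with digit equal to `v`, puts `p (b_j' + z)` in the denominator. The
latter indices form the new state; if it is nonempty, the digit condition leaves at least one net
factor `p`. All else consists of units with Lipschitz gain 1. -/
theorem Admissible.exists_digit_relation (hab : Admissible a b) (n : ℕ) (S : State b) (v : ℕ)
    (hv : v < p) :
    ∃ (S' : State b) (V : ℕ → ℤ_[p]),
      (∀ z, stateCoeff a b n S (v + p * z) = V z * stateCoeff a b (n + 1) S' z) ∧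
      IsLip p 1 V ∧
      (S' = State.empty b ∨ ∃ V₂ : ℕ → ℤ_[p], IsLip p 0 V₂ ∧ ∀ z, V z = p * V₂ z) := by
  classical
  set Sa := Finset.univ.filter fun i => digitZero (dworkIter n (a i)) < v with hSa
  set Sb := Finset.univ.filter fun j => digitZero (dworkIter n (b j)) < v with hSb
  set Se := S.1.filter fun j => digitZero (dworkIter n (b j)) = v with hSe
  have hdisj : Disjoint Sb Se := by
    rw [Finset.disjoint_left]
    intro j h1 h2
    simp only [hSb, hSe, Finset.mem_filter] at h1 h2
    omega
  have hle : ∀ j ∈ Sb ∪ Se, b j ≠ 1 ∧ digit n (b j) ≤ v := by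
    intro j hj
    rcases Finset.mem_union.1 hj with h | h
    · simp only [hSb, Finset.mem_filter, Finset.mem_univ, true_and] at h
      refine ⟨fun h1 => ?_, h.le⟩
      -- All digits of `1` are `p - 1`, never below `v`, so an index with `b_j = 1` does not enter a
      -- state.
      rw [h1, dworkIter_one, digitZero_one] at h
      omega
    · simp only [hSe, Finset.mem_filter] at h
      exact ⟨S.2 j h.1, h.2.le⟩
  have hcard : (Sb ∪ Se).Nonempty → (Sb ∪ Se).card + 1 ≤ Sa.card := fun h =>
    hab.card_le n v _ h hle
  set s := (Sb ∪ Se).card with hs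
  set P : ℕ → ℤ_[p] := fun z => ∏ i ∈ Sa, (dworkIter (n + 1) (a i) + z) with hP
  have hPl : IsLip p 0 P := IsLip.prod _ fun i _ => isLip_add_cast _
  set Ua : ℕ → ℤ_[p]ˣ := fun z =>
    ∏ i, (unitRatio (dworkIter n (a i)) z * unitTail (dworkIter n (a i)) v z) with hUa
  set Ub : ℕ → ℤ_[p]ˣ := fun z =>
    (∏ j, (unitRatio (dworkIter n (b j)) z * unitTail (dworkIter n (b j)) v z)) * unitTail 1 v z
      with hUb
  set Ue : ℕ → ℤ_[p]ˣ := fun z =>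
    ∏ j ∈ S.1, unitPart (dworkIter n (b j) + ((v + p * z : ℕ) : ℤ_[p])) with hUe
  have hUal : IsLip p 1 fun z => (Ua z : ℤ_[p]) := by
    simp only [hUa, Units.coe_prod, Units.val_mul]
    exact IsLip.prod _ fun i _ => (isLip_unitRatio _).mul (isLip_unitTail _ _)
  have hUbl : IsLip p 1 fun z => (Ub z : ℤ_[p]) := by
    simp only [hUb, Units.coe_prod, Units.val_mul]
    exact (IsLip.prod _ fun i _ => (isLip_unitRatio _).mul (isLip_unitTail _ _)).mul
      (isLip_unitTail _ _)
  have hUel : IsLip p 1 fun z => (Ue z : ℤ_[p]) := by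
    simp only [hUe, Units.coe_prod]
    exact IsLip.prod _ fun j _ => isLip_unitPart _ _
  set U : ℕ → ℤ_[p] := fun z => Ua z * (((Ub z)⁻¹ : ℤ_[p]ˣ) * ((Ue z)⁻¹ : ℤ_[p]ˣ)) with hU
  have hUl : IsLip p 1 U := hUal.mul (hUbl.inv.mul hUel.inv)
  have hsa : s ≤ Sa.card := by
    rcases (Sb ∪ Se).eq_empty_or_nonempty with h | h
    · simp [hs, h]
    · exact (Nat.le_succ _).trans (hcard h)
  refine ⟨⟨Sb ∪ Se, fun j hj => (hle j hj).1⟩, fun z => U z * (p ^ (Sa.card - s) * P z),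
    fun z => ?_, ?_, ?_⟩
  · have hnum : hypNum (fun i => dworkIter n (a i)) (v + p * z)
        = (unitPoch (1 : ℤ_[p]) (p * z) : ℤ_[p]) ^ (r + 1) * Ua z * (p ^ z) ^ (r + 1)
          * hypNum (fun i => dworkIter (n + 1) (a i)) z * (p ^ Sa.card * P z) := by
      simp only [hypNum, hP, dworkIter_succ, hUa, hSa]
      rw [prod_zpoch_digit _ z v hv, Fintype.card_fin]
    have hden : hypDen (fun j => dworkIter n (b j)) (v + p * z)
          * ∏ j ∈ S.1, (dworkIter n (b j) + (v + p * z : ℕ))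
        = (unitPoch (1 : ℤ_[p]) (p * z) : ℤ_[p]) ^ (r + 1) * (Ub z * Ue z) * (p ^ z) ^ (r + 1)
          * p ^ s * (hypDen (fun j => dworkIter (n + 1) (b j)) z
            * ∏ j ∈ Sb ∪ Se, (dworkIter (n + 1) (b j) + z)) := by
      rw [hypDen_digit _ z v hv, prod_add_digit_state _ S.1 z v hv, hs,
        Finset.card_union_of_disjoint hdisj, Finset.prod_union hdisj]
      simp only [dworkIter_succ, hUb, hUe, hSb, hSe, pow_add]
      ring
    have hne : ∀ n z, ∀ T : Finset (Fin r), hypDen (fun j => dworkIter n (b j)) z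
        * ∏ j ∈ T, (dworkIter n (b j) + z) ≠ 0 := fun n z T =>
      mul_ne_zero (hypDen_ne_zero (hab.add_ne_zero n) z)
        (Finset.prod_ne_zero_iff.2 fun j _ => hab.add_ne_zero n j z)
    have hne1 := hne n (v + p * z) S.1
    have hne2 := hne (n + 1) z (Sb ∪ Se)
    rw [stateCoeff, stateCoeff, ← mul_div_assoc, div_eq_div_iff]
    · rw [← PadicInt.coe_mul, ← PadicInt.coe_mul, ← PadicInt.coe_mul]
      refine congrArg (fun x : ℤ_[p] => (x : ℚ_[p])) ?_
      rw [hnum, hden]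
      have hpp : (p : ℤ_[p]) ^ Sa.card = p ^ (Sa.card - s) * p ^ s := by
        rw [← pow_add, Nat.sub_add_cancel hsa]
      rw [hpp, hU]
      have hb := (Ub z).inv_mul
      have he := (Ue z).inv_mul
      generalize hypDen (fun j => dworkIter (n + 1) (b j)) z
        * ∏ j ∈ Sb ∪ Se, (dworkIter (n + 1) (b j) + z) = D
      simp only
      generalize (((Ub z)⁻¹ : ℤ_[p]ˣ) : ℤ_[p]) = x at *
      generalize (((Ue z)⁻¹ : ℤ_[p]ˣ) : ℤ_[p]) = y at *
      generalize ((Ub z : ℤ_[p]ˣ) : ℤ_[p]) = x' at *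
      generalize ((Ue z : ℤ_[p]ˣ) : ℤ_[p]) = y' at *
      generalize ((Ua z : ℤ_[p]ˣ) : ℤ_[p]) = w at *
      generalize (unitPoch (1 : ℤ_[p]) (p * z) : ℤ_[p]) ^ (r + 1) = c at *
      generalize ((p : ℤ_[p]) ^ z) ^ (r + 1) = d at *
      generalize hypNum (fun i => dworkIter (n + 1) (a i)) z = N at *
      generalize (p : ℤ_[p]) ^ (Sa.card - s) = e at *
      generalize (p : ℤ_[p]) ^ s = f at *
      generalize P z = g at *
      linear_combination (-(c * w * d * N * e * f * g * D) * (y * y')) * hb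
        - (c * w * d * N * e * f * g * D) * he
    · exact coe_ne_zero hne1
    · exact coe_ne_zero hne2
  -- `P` alone has gain 0. It is either the empty product or accompanied by at least one factor `p`,
  -- which gives gain 1.
  · refine hUl.mul ?_
    rcases (Sb ∪ Se).eq_empty_or_nonempty with h | h
    · rcases Nat.eq_zero_or_pos Sa.card with h0 | h0
      · have : P = fun _ => 1 := by funext z; simp [hP, Finset.card_eq_zero.1 h0]
        rw [this]; exact (IsLip.const _ _ _)
      · exact (hPl.pow_mul _).mono (by
          have : s = 0 := by simp [hs, h]
          omega)
    · exact (hPl.pow_mul _).mono (by have := hcard h; omega)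
  · rcases (Sb ∪ Se).eq_empty_or_nonempty with h | h
    · exact Or.inl (Subtype.ext h)
    · refine Or.inr ⟨fun z => U z * (p ^ (Sa.card - s - 1) * P z),
        (hUl.mono zero_le_one).mul ((hPl.pow_mul _).mono (Nat.zero_le _)), fun z => ?_⟩
      have := hcard h
      rw [show Sa.card - s = (Sa.card - s - 1) + 1 by omega, pow_succ]
      simp only [Nat.add_sub_cancel]
      ring

/-- Digit relations with integral `V` reduce `z` to `z / p`. At `z = 0` only `∏_{j ∈ S} b_j^{(n)}`
remains in the denominator, a unit by hypothesis. -/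
theorem Admissible.norm_stateCoeff_le (hab : Admissible a b) (z : ℕ) :
    ∀ n S, ‖stateCoeff a b n S z‖ ≤ 1 := by
  induction z using Nat.strong_induction_on with
  | _ z ih =>
    intro n S
    rcases Nat.eq_zero_or_pos z with rfl | hz
    · have h1 : ‖∏ j ∈ S.1, dworkIter n (b j)‖ = 1 := by
        rw [norm_prod]
        exact Finset.prod_eq_one fun j hj => hab.norm_b j (S.2 j hj) n
      simp only [stateCoeff, hypNum, hypDen, zpoch, Finset.range_zero, Finset.prod_empty,
        Finset.prod_const_one, mul_one, one_mul, Nat.cast_zero, add_zero, PadicInt.coe_one]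
      rw [norm_div, norm_one, ← PadicInt.norm_def, h1, div_one]
    · obtain ⟨S', V, hV, -, -⟩ := hab.exists_digit_relation n S (z % p) (Nat.mod_lt _ hp.out.pos)
      rw [← Nat.mod_add_div z p, hV, norm_mul]
      exact mul_le_one₀ (V _).2 (norm_nonneg _)
        (ih _ (Nat.div_lt_self hz hp.out.one_lt) (n + 1) S')

/-- The `p`-adic integers `stateCoeff a b n S z`. -/
def intCoeff (hab : Admissible a b) (n : ℕ) (S : State b) (z : ℕ) : ℤ_[p] :=
  ⟨stateCoeff a b n S z, hab.norm_stateCoeff_le z n S⟩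

theorem coe_intCoeff (hab : Admissible a b) (n : ℕ) (S : State b) (z : ℕ) :
    (intCoeff hab n S z : ℚ_[p]) = stateCoeff a b n S z := rfl

theorem isDworkSystem_intCoeff (hab : Admissible a b) :
    IsDworkSystem p (State.empty b) (intCoeff hab) := by
  intro n S v hv
  obtain ⟨S', V, h1, h2, h3⟩ := hab.exists_digit_relation n S v hv
  exact ⟨S', V, fun z => by
    apply PadicInt.ext; rw [PadicInt.coe_mul, coe_intCoeff, coe_intCoeff, h1], h2, h3⟩

theorem intCoeff_zero (hab : Admissible a b) (n : ℕ) : intCoeff hab n (State.empty b) 0 = 1 := by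
  apply PadicInt.ext
  simp [coe_intCoeff, stateCoeff, hypNum, hypDen, zpoch, State.empty]

theorem hypSeries_eq (hab : Admissible a b) (n : ℕ) :
    hypSeries (fun k => dworkIter n (a k)) (fun k => dworkIter n (b k))
      = PowerSeries.mk fun z => (intCoeff hab n (State.empty b) z : ℚ_[p]) := by
  ext z
  have hprod : ∀ {ι : Type} [Fintype ι] (α : ι → ℤ_[p]),
      ((∏ i, zpoch (α i) z : ℤ_[p]) : ℚ_[p]) = ∏ i, poch (α i) z := by
    intro ι _ α
    simp_rw [← coe_zpoch]
    exact map_prod (PadicInt.Coe.ringHom (p := p)) _ _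
  simp only [hypSeries, PowerSeries.coeff_mk, coe_intCoeff, stateCoeff, State.empty,
    Finset.prod_empty, mul_one, hypNum, hypDen, PadicInt.coe_mul, hprod, coe_zpoch]

/-- For last digit `0` no digit lies below it, so neither powers of `p` nor linear factors appear,
only the unit ratios. -/
theorem intCoeff_p_mul (hab : Admissible a b) (n z : ℕ) :
    intCoeff hab n (State.empty b) (p * z)
      * ∏ j, (unitRatio (dworkIter n (b j)) z : ℤ_[p])
      = (∏ i, (unitRatio (dworkIter n (a i)) z : ℤ_[p]))
        * intCoeff hab (n + 1) (State.empty b) z := by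
  have hnum := prod_zpoch_digit (fun i => dworkIter n (a i)) z 0 hp.out.pos
  have hden := hypDen_digit (fun j => dworkIter n (b j)) z 0 hp.out.pos
  simp only [zero_add, unitTail, Finset.range_zero, Finset.prod_empty, mul_one, not_lt_zero,
    Finset.filter_false, Finset.card_empty, pow_zero, Fintype.card_fin, Units.coe_prod,
    ← dworkIter_succ] at hnum hden
  have hne0 := hypDen_ne_zero (hab.add_ne_zero n) (p * z)
  have hne1 := hypDen_ne_zero (hab.add_ne_zero (n + 1)) z
  have h0 : intCoeff hab n (State.empty b) (p * z)
      * hypDen (fun j => dworkIter n (b j)) (p * z)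
      = hypNum (fun i => dworkIter n (a i)) (p * z) := by
    apply PadicInt.ext
    rw [PadicInt.coe_mul, coe_intCoeff, stateCoeff]
    simp only [State.empty, Finset.prod_empty, mul_one]
    exact div_mul_cancel₀ _ (coe_ne_zero hne0)
  have h1 : intCoeff hab (n + 1) (State.empty b) z
      * hypDen (fun j => dworkIter (n + 1) (b j)) z
      = hypNum (fun i => dworkIter (n + 1) (a i)) z := by
    apply PadicInt.ext
    rw [PadicInt.coe_mul, coe_intCoeff, stateCoeff]
    simp only [State.empty, Finset.prod_empty, mul_one]
    exact div_mul_cancel₀ _ (coe_ne_zero hne1)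
  have hc : (unitPoch (1 : ℤ_[p]) (p * z) : ℤ_[p]) ^ (r + 1) * (p ^ z) ^ (r + 1)
      * hypDen (fun j => dworkIter (n + 1) (b j)) z ≠ 0 :=
    mul_ne_zero (mul_ne_zero (pow_ne_zero _ (Units.ne_zero _))
      (pow_ne_zero _ (pow_ne_zero _ p_ne_zero))) hne1
  refine mul_right_cancel₀ hc ?_
  rw [hden] at h0
  rw [hypNum, hnum] at h0
  rw [hypNum] at h1
  rw [← h1] at h0
  linear_combination h0

end System

/-! ### Completeness and absolute value of the Witt ring. -/

section Witt

theorem mem_span_pow_iff_dvd {p : ℕ} {A : Type*} [CommRing A] {x : A} {n : ℕ} :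
    x ∈ Ideal.span {(p : A)} ^ n ↔ (p : A) ^ n ∣ x := by
  rw [Ideal.span_singleton_pow, Ideal.mem_span_singleton]

variable (p : ℕ) [hp : Fact p.Prime]

theorem witt_p_ne_zero : (p : W p) ≠ 0 := WittVector.p_nonzero p _

theorem witt_natCast_ne_zero {n : ℕ} (hn : n ≠ 0) : (n : W p) ≠ 0 := by
  rw [← map_natCast (zpToW p), Ne, map_eq_zero_iff _ (zpToW_injective p)]
  exact_mod_cast hn

theorem K_natCast_ne_zero {n : ℕ} (hn : n ≠ 0) : (n : K p) ≠ 0 := by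
  rw [← map_natCast (algebraMap (W p) (K p)), Ne,
    map_eq_zero_iff _ (IsFractionRing.injective (W p) (K p))]
  exact witt_natCast_ne_zero p hn

theorem qpToK_coe (x : ℤ_[p]) : qpToK p x = algebraMap (W p) (K p) (zpToW p x) := by
  have h := IsFractionRing.lift_algebraMap (A := ℤ_[p]) (K := ℚ_[p])
    (g := (algebraMap (W p) (K p)).comp (zpToW p))
    ((IsFractionRing.injective (W p) (K p)).comp (zpToW_injective p)) x
  exact h

theorem padicAbs_coe_p_lt_one : padicAbs p (algebraMap (W p) (K p) p) < 1 := by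
  rw [padicAbs, IsDedekindDomain.HeightOneSpectrum.adicAbv_coe_lt_one_iff]
  exact (IsLocalRing.mem_maximalIdeal _).2 (WittVector.irreducible p).not_isUnit

theorem padicAbs_coe_le_pow {x : W p} {n : ℕ} (h : (p : W p) ^ n ∣ x) :
    padicAbs p (algebraMap (W p) (K p) x) ≤ padicAbs p (algebraMap (W p) (K p) p) ^ n := by
  obtain ⟨y, rfl⟩ := h
  rw [map_mul, map_mul, map_pow, map_pow]
  exact mul_le_of_le_one_right (pow_nonneg ((padicAbs p).nonneg _) _)
    (IsDedekindDomain.HeightOneSpectrum.adicAbv_coe_le_one _ _ _)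

theorem isUnit_of_padicAbs_eq_one {x : W p} (h : padicAbs p (algebraMap (W p) (K p) x) = 1) :
    IsUnit x := by
  rw [padicAbs, IsDedekindDomain.HeightOneSpectrum.adicAbv_coe_eq_one_iff] at h
  by_contra hx
  exact h ((IsLocalRing.mem_maximalIdeal _).2 hx)

theorem isPadicLimit_of_dvd {u : ℕ → W p} {x : W p}
    (h : ∀ n : ℕ, ∀ᶠ m in atTop, (p : W p) ^ n ∣ u m - x) :
    IsPadicLimit p (fun m => algebraMap (W p) (K p) (u m)) (algebraMap (W p) (K p) x) := by
  rw [IsPadicLimit, Metric.tendsto_atTop']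
  intro ε hε
  obtain ⟨n, hn⟩ := exists_pow_lt_of_lt_one hε (padicAbs_coe_p_lt_one p)
  obtain ⟨N, hN⟩ := eventually_atTop.1 (h n)
  refine ⟨N, fun m hm => ?_⟩
  rw [Real.dist_eq, sub_zero, abs_of_nonneg ((padicAbs p).nonneg _), ← map_sub]
  exact (padicAbs_coe_le_pow p (hN m hm.le)).trans_lt hn

theorem IsPadicLimit.unique {u : ℕ → K p} {x y : K p} (hx : IsPadicLimit p u x)
    (hy : IsPadicLimit p u y) : x = y := by
  have h := hx.add hy
  rw [add_zero] at h
  have h' : padicAbs p (x - y) ≤ 0 := by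
    refine ge_of_tendsto' h fun m => ?_
    have e : x - y = (u m - y) - (u m - x) := by ring
    rw [e, add_comm]
    exact (padicAbs p).sub_le_add _ _
  exact sub_eq_zero.1 ((padicAbs p).eq_zero.1 (le_antisymm h' ((padicAbs p).nonneg _)))

theorem witt_exists_limit (f : ℕ → W p) (hf : ∀ n, (p : W p) ^ n ∣ f (n + 1) - f n) :
    ∃ L : W p, ∀ n, (p : W p) ^ n ∣ f n - L := by
  have hf' : ∀ {m n}, m ≤ n → (p : W p) ^ m ∣ f m - f n := by
    intro m n hmn
    induction n, hmn using Nat.le_induction with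
    | base => simp
    | succ n hn ih =>
      rw [← sub_sub_sub_cancel_right _ _ (f n)]
      simpa using dvd_sub ih ((pow_dvd_pow _ hn).trans (hf n))
  obtain ⟨L, hL⟩ := IsPrecomplete.prec (I := Ideal.span {(p : W p)}) (M := W p)
    inferInstance (f := f) fun {m n} hmn => by
      rw [SModEq.sub_mem, smul_eq_mul, Ideal.mul_top, mem_span_pow_iff_dvd]
      exact hf' hmn
  refine ⟨L, fun n => ?_⟩
  have := hL n
  rwa [SModEq.sub_mem, smul_eq_mul, Ideal.mul_top, mem_span_pow_iff_dvd] at this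

theorem witt_eq_of_dvd {x y : W p} (h : ∀ n, (p : W p) ^ n ∣ x - y) : x = y := by
  rw [← sub_eq_zero]
  refine IsHausdorff.haus (I := Ideal.span {(p : W p)}) inferInstance _ fun n => ?_
  rw [SModEq.zero, smul_eq_mul, Ideal.mul_top, mem_span_pow_iff_dvd]
  exact h n

end Witt

/-! ### The logarithm as the derivative of `l ↦ c^l` at `0`. -/

section Logarithm

variable {p : ℕ} [hp : Fact p.Prime]

theorem pow_padicValNat_eq {n : ℕ} (hn : n ≠ 0) :
    ∃ u : ℤ_[p]ˣ, (n : ℤ_[p]) = u * p ^ padicValNat p n := by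
  have h0 : (n : ℤ_[p]) ≠ 0 := by exact_mod_cast hn
  have h := PadicInt.unitCoeff_spec h0
  have hv : (n : ℤ_[p]).valuation = padicValNat p n := by
    have := PadicInt.valuation_coe (n : ℤ_[p])
    rw [PadicInt.coe_natCast, Padic.valuation_natCast] at this
    exact_mod_cast this.symm
  rw [hv] at h
  exact ⟨_, h⟩

/-- The `p`-adic valuation of `(k+1)!` is less than `k + 1`. -/
theorem exists_mul_factorial_eq_pow (k : ℕ) :
    ∃ κ : ℤ_[p], κ * ((k + 1).factorial : ℤ_[p]) = p ^ k := by
  obtain ⟨u, hu⟩ := pow_padicValNat_eq (p := p) (Nat.factorial_ne_zero (k + 1))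
  have hlt := padicValNat_factorial_lt_of_ne_zero p (Nat.succ_ne_zero k)
  refine ⟨(u⁻¹ : ℤ_[p]ˣ) * p ^ (k - padicValNat p (k + 1).factorial), ?_⟩
  rw [hu]
  have : k = (k - padicValNat p (k + 1).factorial) + padicValNat p (k + 1).factorial := by
    simp only [Nat.succ_eq_add_one] at hlt; omega
  conv_rhs => rw [this, pow_add]
  have h1 := u.inv_mul
  linear_combination ((p : ℤ_[p]) ^ (k - padicValNat p (k + 1).factorial)
    * p ^ padicValNat p (k + 1).factorial) * h1

/-- If `v` is the valuation of `k + 1`, then `2 v ≤ k + 1` because `2 v ≤ 2^v` for `v > 0`; hence `k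
- v ≥ n`. -/
theorem pow_dvd_of_mul_eq_pow {x : ℤ_[p]} {k n : ℕ} (h : x * ((k + 1 : ℕ) : ℤ_[p]) = p ^ k)
    (hk : 2 * n + 1 ≤ k) : (p : ℤ_[p]) ^ n ∣ x := by
  obtain ⟨u, hu⟩ := pow_padicValNat_eq (p := p) (Nat.succ_ne_zero k)
  set v := padicValNat p (k + 1) with hv
  have hv2 : 2 * v ≤ k + 1 := by
    have h1 : p ^ v ≤ k + 1 := Nat.le_of_dvd (Nat.succ_pos k) pow_padicValNat_dvd
    have h2 : 2 ^ v ≤ p ^ v := Nat.pow_le_pow_left hp.out.two_le v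
    have h3 : 2 * v ≤ 2 ^ v := by
      rcases v with _ | v
      · simp
      · rw [pow_succ']
        exact Nat.mul_le_mul_left _ (Nat.lt_two_pow_self)
    omega
  have h4 : x * u * p ^ v = p ^ (k - v) * p ^ v := by
    rw [← pow_add, Nat.sub_add_cancel (by omega), ← h, mul_assoc, ← hu]
  have h5 := mul_right_cancel₀ (pow_ne_zero v (p_ne_zero (p := p))) h4
  have h6 : (p : ℤ_[p]) ^ n ∣ x * u := by
    rw [h5]; exact pow_dvd_pow _ (by omega)
  exact Units.dvd_mul_right.1 h6

/-- The number `p ^ k / (k + 1)!` in `ℤ_p`. -/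
def powDivFactorial (p : ℕ) [Fact p.Prime] (k : ℕ) : ℤ_[p] :=
  (exists_mul_factorial_eq_pow k).choose

theorem powDivFactorial_mul (k : ℕ) :
    powDivFactorial p k * ((k + 1).factorial : ℤ_[p]) = p ^ k :=
  (exists_mul_factorial_eq_pow k).choose_spec

/-- The term `p ^ k (l - 1) ⋯ (l - k) w ^ (k + 1) / (k + 1)!` of the expansion of
`((1 + p w) ^ l - 1) / (p l)`. -/
def powTerm (w : W p) (k l : ℕ) : W p :=
  zpToW p (powDivFactorial p k) * (∏ j ∈ Finset.range k, (-((j : W p) + 1) + l)) * w ^ (k + 1)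

theorem isLip_powTerm (w : W p) (k : ℕ) : IsLip p 0 (powTerm w k) :=
  ((IsLip.const p 0 _).mul (IsLip.prod _ fun _ _ => isLip_add_cast _)).mul (IsLip.const p 0 _)

theorem powTerm_eq_zero (w : W p) {k l : ℕ} (hl : l ≠ 0) (hkl : l ≤ k) : powTerm w k l = 0 := by
  have h : ∏ j ∈ Finset.range k, (-((j : W p) + 1) + l) = 0 := by
    refine Finset.prod_eq_zero (Finset.mem_range.2 (show l - 1 < k by omega)) ?_
    rw [Nat.cast_sub (by omega)]; simp
  rw [powTerm, h, mul_zero, zero_mul]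

theorem mul_prod_sub_eq_choose {R : Type*} [CommRing R] (l k : ℕ) :
    (l : R) * ∏ j ∈ Finset.range k, (-((j : R) + 1) + l) = (k + 1).factorial * l.choose (k + 1) := by
  have h : ((l.descFactorial (k + 1) : ℕ) : R) = ∏ j ∈ Finset.range (k + 1), ((l : R) - j) := by
    rw [← descPochhammer_eval_eq_descFactorial, descPochhammer_eval_eq_prod_range]
  rw [← Nat.cast_mul, ← Nat.descFactorial_eq_factorial_mul_choose, h, Finset.prod_range_succ']
  simp only [Nat.cast_zero, sub_zero]
  rw [mul_comm]
  congr 1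
  exact Finset.prod_congr rfl fun j _ => by push_cast; ring

theorem natCast_mul_powTerm (w : W p) (k l : ℕ) :
    (p : W p) * l * powTerm w k l = (p * w) ^ (k + 1) * l.choose (k + 1) := by
  have h1 := mul_prod_sub_eq_choose (R := W p) l k
  have h2 := congrArg (zpToW p) (powDivFactorial_mul (p := p) k)
  simp only [map_mul, map_natCast, map_pow] at h2
  rw [powTerm]
  linear_combination (p * zpToW p (powDivFactorial p k) * w ^ (k + 1)) * h1
    + (p * w ^ (k + 1) * l.choose (k + 1)) * h2

theorem one_add_pow_eq (w : W p) (l : ℕ) {M : ℕ} (hM : l ≤ M) :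
    (1 + p * w) ^ l = 1 + p * l * ∑ k ∈ Finset.range M, powTerm w k l := by
  rcases Nat.eq_zero_or_pos l with rfl | hl
  · simp
  rw [← Finset.sum_subset (Finset.range_mono hM) (fun k _ hk => powTerm_eq_zero w hl.ne'
    (by simpa using hk)), Finset.mul_sum, add_comm 1, add_pow, Finset.sum_range_succ', add_comm]
  simp only [natCast_mul_powTerm, one_pow, mul_one, pow_zero, Nat.choose_zero_right, Nat.cast_one]

theorem prod_neg_add_one {R : Type*} [CommRing R] (k : ℕ) :
    ∏ j ∈ Finset.range k, (-((j : R) + 1) + (0 : ℕ)) = (-1) ^ k * k.factorial := by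
  rw [← Finset.prod_range_add_one_eq_factorial]
  push_cast
  rw [← Finset.card_range k, ← Finset.prod_const, Finset.card_range, ← Finset.prod_mul_distrib]
  exact Finset.prod_congr rfl fun j _ => by ring

theorem powTerm_zero_mul (w : W p) (k : ℕ) :
    powTerm w k 0 * ((k : W p) + 1) = (-1) ^ k * p ^ k * w ^ (k + 1) := by
  have h2 := congrArg (zpToW p) (powDivFactorial_mul (p := p) k)
  simp only [map_mul, map_natCast, map_pow, Nat.factorial_succ] at h2
  push_cast at h2
  rw [powTerm, prod_neg_add_one]
  linear_combination ((-1) ^ k * w ^ (k + 1)) * h2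

theorem pow_dvd_powTerm_zero (w : W p) {k n : ℕ} (hk : 2 * n + 1 ≤ k) :
    (p : W p) ^ n ∣ powTerm w k 0 := by
  have h : (p : ℤ_[p]) ^ n ∣ powDivFactorial p k * (k.factorial : ℤ_[p]) := by
    refine pow_dvd_of_mul_eq_pow ?_ hk
    rw [← powDivFactorial_mul, Nat.factorial_succ]
    push_cast; ring
  have h' := map_dvd (zpToW p) h
  simp only [map_mul, map_natCast, map_pow] at h'
  have e : powTerm w k 0 = (zpToW p (powDivFactorial p k) * k.factorial)
      * ((-1) ^ k * w ^ (k + 1)) := by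
    rw [powTerm, prod_neg_add_one]; ring
  rw [e]
  exact h'.mul_right _

/-- The binomial expansion of `((1 + p w)^l - 1) / (p l)` has terms that are integral polynomials in
`l`, hence Lipschitz. At `l = 0` it becomes the logarithm series divided by `p`. -/
theorem exists_isNice_pow (w : W p) :
    ∃ Φ : ℕ → W p, IsNice p (fun l => (1 + p * w) ^ l) Φ ∧
      algebraMap (W p) (K p) (p * Φ 0) = logK p (algebraMap (W p) (K p) (1 + p * w)) := by
  set s : ℕ → ℕ → W p := fun M l => ∑ k ∈ Finset.range M, powTerm w k l with hs
  have hsl : ∀ M, IsLip p 0 (s M) := by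
    intro M
    induction M with
    | zero => simpa [hs] using IsLip.const p 0 (0 : W p)
    | succ M ih =>
      simp only [hs, Finset.sum_range_succ] at ih ⊢
      exact ih.add (isLip_powTerm w M)
  have htail : ∀ {n M M'}, 2 * n + 1 ≤ M → M ≤ M' → (p : W p) ^ n ∣ s M' 0 - s M 0 := by
    intro n M M' h1 h2
    rw [hs]
    simp only
    rw [← Finset.sum_sdiff_eq_sub (Finset.range_mono h2)]
    refine Finset.dvd_sum fun k hk => pow_dvd_powTerm_zero w ?_
    simp only [Finset.mem_sdiff, Finset.mem_range] at hk
    omega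
  obtain ⟨y, hy⟩ := witt_exists_limit p (fun n => s (2 * n + 1) 0)
    fun n => htail le_rfl (by omega)
  have hy' : ∀ {n M}, 2 * n + 1 ≤ M → (p : W p) ^ n ∣ s M 0 - y := by
    intro n M h
    rw [← sub_add_sub_cancel _ (s (2 * n + 1) 0)]
    exact dvd_add (htail le_rfl h) (hy n)
  -- For `l ≠ 0` the sum stops by itself at `k = l`; only at `l = 0` is it a genuine infinite
  -- series, with sum `y`.
  set Φ : ℕ → W p := fun l => if l = 0 then y else s l l with hΦ
  have happrox : ∀ {k l M}, 2 * k + 1 ≤ M → l ≤ M → (p : W p) ^ k ∣ s M l - Φ l := by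
    intro k l M h1 h2
    by_cases hl : l = 0
    · subst hl; simpa [hΦ] using hy' h1
    · have : s M l = s l l := (Finset.sum_subset (Finset.range_mono h2) fun k _ hk =>
        powTerm_eq_zero w hl (by simpa using hk)).symm
      simp [hΦ, hl, this]
  refine ⟨Φ, ⟨fun l => ?_, fun k z z' hz => ?_⟩, ?_⟩
  · by_cases hl : l = 0
    · subst hl; simp
    · simp only [hΦ, hl, if_false]
      exact one_add_pow_eq w l le_rfl
  · set M := 2 * k + 1 + z + z'
    have h1 := happrox (k := k) (l := z) (M := M) (by omega) (by omega)
    have h2 := happrox (k := k) (l := z') (M := M) (by omega) (by omega)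
    have h3 := hsl M k z z' hz
    have e : Φ z - Φ z' = (s M z - s M z') - (s M z - Φ z) + (s M z' - Φ z') := by ring
    rw [e]
    exact dvd_add (dvd_sub h3 h1) h2
  · have hlim : IsPadicLimit p (fun m => - ∑ n ∈ Finset.range m,
        (1 - algebraMap (W p) (K p) (1 + p * w)) ^ (n + 1) / ((n : K p) + 1))
        (algebraMap (W p) (K p) (p * Φ 0)) := by
      have e : ∀ m, - ∑ n ∈ Finset.range m,
          (1 - algebraMap (W p) (K p) (1 + p * w)) ^ (n + 1) / ((n : K p) + 1)
          = algebraMap (W p) (K p) (p * s m 0) := by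
        intro m
        simp only [hs, map_mul, map_sum]
        rw [Finset.mul_sum, ← Finset.sum_neg_distrib]
        refine Finset.sum_congr rfl fun n _ => ?_
        have hn : ((n : K p) + 1) ≠ 0 := by exact_mod_cast K_natCast_ne_zero p n.succ_ne_zero
        rw [← neg_div, div_eq_iff hn]
        have h := congrArg (algebraMap (W p) (K p)) (powTerm_zero_mul w n)
        simp only [map_mul, map_add, map_natCast, map_pow, map_neg, map_one] at h ⊢
        have e2 : (1 : K p) - (1 + p * algebraMap (W p) (K p) w)
          = (-1) * (p * algebraMap (W p) (K p) w) := by ring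
        rw [e2, mul_pow, mul_pow, pow_succ (-1 : K p), pow_succ (p : K p)]
        linear_combination (-(p : K p)) * h
      simp only [e]
      refine isPadicLimit_of_dvd p fun n => ?_
      filter_upwards [eventually_ge_atTop (2 * n + 1)] with m hm
      rw [← mul_sub]
      refine Dvd.dvd.mul_left ?_ _
      simpa [hΦ] using hy' hm
    have hex : ∃ x : K p, IsPadicLimit p (fun m => - ∑ n ∈ Finset.range m,
        (1 - algebraMap (W p) (K p) (1 + p * w)) ^ (n + 1) / ((n : K p) + 1)) x := ⟨_, hlim⟩
    rw [logK, dif_pos hex]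
    exact hlim.unique p hex.choose_spec

end Logarithm

/-! ### The quotients of the coefficients of `G` by those of `F`. -/

section Weight

variable {p : ℕ} [hp : Fact p.Prime] {r : ℕ} {a : Fin (r + 1) → ℤ_[p]} {b : Fin r → ℤ_[p]}

/-- The coefficients of `F^{(n)}` in `W`. -/
def wittCoeff (hab : Admissible a b) (n : ℕ) (S : State b) (z : ℕ) : W p :=
  zpToW p (intCoeff hab n S z)

theorem isDworkSystem_wittCoeff (hab : Admissible a b) :
    IsDworkSystem p (State.empty b) (wittCoeff hab) :=
  (isDworkSystem_intCoeff hab).map (zpToW p)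

/-- The series `F^{(n)}` over `W`. -/
def wittF (hab : Admissible a b) (n : ℕ) : PowerSeries (W p) :=
  PowerSeries.mk (wittCoeff hab n (State.empty b))

theorem map_wittF (hab : Admissible a b) (n : ℕ) :
    PowerSeries.map (algebraMap (W p) (K p)) (wittF hab n) = hypF a b n := by
  ext z
  rw [hypF, hypSeries_eq hab, wittF]
  simp only [PowerSeries.coeff_map, PowerSeries.coeff_mk, wittCoeff, qpToK_coe]

/-- The factor of proportionality between `A^{(0)}_{pl}` and `A^{(1)}_l`. -/
def gammaRatio (a : Fin (r + 1) → ℤ_[p]) (b : Fin r → ℤ_[p]) (l : ℕ) : ℤ_[p]ˣ :=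
  (∏ i, unitRatio (a i) l) * (∏ j, unitRatio (b j) l)⁻¹

theorem intCoeff_p_mul_eq (hab : Admissible a b) (l : ℕ) :
    intCoeff hab 0 (State.empty b) (p * l)
      = gammaRatio a b l * intCoeff hab 1 (State.empty b) l := by
  have h := intCoeff_p_mul hab 0 l
  simp only [dworkIter, Function.iterate_zero, id_eq, zero_add] at h
  have h2 := (∏ j, unitRatio (b j) l).mul_inv
  rw [gammaRatio, Units.val_mul]
  simp only [Units.coe_prod] at h2 ⊢
  generalize (((∏ j, unitRatio (b j) l)⁻¹ : ℤ_[p]ˣ) : ℤ_[p]) = x at *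
  linear_combination x * h - (intCoeff hab 0 (State.empty b) (p * l)) * h2

theorem exists_isNice_gammaRatio (a : Fin (r + 1) → ℤ_[p]) (b : Fin r → ℤ_[p]) :
    ∃ Φ : ℕ → ℤ_[p], IsNice p (fun l => (gammaRatio a b l : ℤ_[p])) Φ ∧
      (Φ 0 : ℚ_[p]) = ∑ i, psiTilde (a i) - ∑ j, psiTilde (b j) := by
  have key : ∀ {ι : Type} [Fintype ι] (c : ι → ℤ_[p]), ∃ Φ : ℕ → ℤ_[p],
      IsNice p (fun l => ((∏ i, unitRatio (c i) l : ℤ_[p]ˣ) : ℤ_[p])) Φ ∧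
      (Φ 0 : ℚ_[p]) = ∑ i, psiTilde (c i) := by
    intro ι _ c
    choose Φ hΦ h0 using fun i => exists_isNice_unitRatio (c i)
    obtain ⟨Ψ, hΨ, hΨ0⟩ := exists_isNice_prod Finset.univ fun i _ => hΦ i
    refine ⟨Ψ, by simpa only [Units.coe_prod] using hΨ, ?_⟩
    rw [hΨ0]
    simp_rw [← h0]
    exact map_sum (PadicInt.Coe.ringHom (p := p)) _ _
  obtain ⟨Φa, hΦa, ha⟩ := key a
  obtain ⟨Φb, hΦb, hb⟩ := key b
  refine ⟨_, by simpa only [gammaRatio, Units.val_mul] using hΦa.mul hΦb.inv, ?_⟩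
  simp only [hΦb.inv.apply_zero, mul_one, PadicInt.coe_add, PadicInt.coe_neg, ha, hb]
  ring

theorem coeff_zero_hypG (a : Fin (r + 1) → ℤ_[p]) (b : Fin r → ℤ_[p]) (c : W p) :
    PowerSeries.coeff 0 (hypG a b c)
      = qpToK p (∑ i, psi (a i) - ∑ j, psi (b j) + eulerConst p)
        - (p : K p)⁻¹ * logK p (algebraMap (W p) (K p) c) := by
  rw [hypG, (PowerSeries.coeff 0).map_add, PowerSeries.coeff_zero_C, integ, PowerSeries.coeff_mk,
    Nat.cast_zero, div_zero, add_zero]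

theorem coeff_hypG {k : ℕ} (hk : k ≠ 0) (a : Fin (r + 1) → ℤ_[p]) (b : Fin r → ℤ_[p]) (c : W p) :
    PowerSeries.coeff k (hypG a b c) = (PowerSeries.coeff k (hypF a b 0)
      - if p ∣ k then algebraMap (W p) (K p) c ^ (k / p) * PowerSeries.coeff (k / p) (hypF a b 1)
        else 0) / k := by
  rw [hypG, (PowerSeries.coeff k).map_add, PowerSeries.coeff_C, if_neg hk, zero_add, integ,
    PowerSeries.coeff_mk, map_sub, substSigma, PowerSeries.coeff_mk]

theorem witt_mul_inv {z : ℕ} (hz : ¬ p ∣ z) :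
    (z : W p) * Ring.inverse (z : W p) = 1 := by
  refine Ring.mul_inverse_cancel _ ?_
  have h := ((isUnit_natCast_iff (p := p) z).2 hz).map (zpToW p)
  rwa [map_natCast] at h

/-- The quotients `B_k / A_k` of the coefficients of `G` and `F` form, up to the factor `p`,
a Lipschitz sequence. -/
theorem exists_weight (hab : Admissible a b) (w : W p) :
    ∃ q : ℕ → W p, IsLip p 0 (fun k => p * q k) ∧
      PowerSeries.map (algebraMap (W p) (K p))
        (PowerSeries.mk fun k => q k * wittCoeff hab 0 (State.empty b) k)
        = hypG a b (1 + p * w) := by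
  obtain ⟨Φc, hΦc, hc0⟩ := exists_isNice_pow w
  obtain ⟨Φu, hΦu, hu0⟩ := exists_isNice_gammaRatio a b
  have hinv := (hΦu.inv).map (zpToW p)
  have hg := hΦc.mul hinv
  set v : ℕ → W p := fun l => zpToW p ((gammaRatio a b l)⁻¹ : ℤ_[p]ˣ) with hv
  set Φ : ℕ → W p := fun l => Φc l * v l
    + zpToW p (-(Φu l * ((gammaRatio a b l)⁻¹ : ℤ_[p]ˣ))) with hΦ
  have hv0 : v 0 = 1 := hinv.apply_zero
  -- Here `c^l / γ(l) = 1 + p l Φ(l)`, so `(1 - c^l / γ(l)) / (p l) = -Φ(l)`; the value at `k = 0`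
  -- is the one forced by continuity.
  refine ⟨fun k => if p ∣ k then - Φ (k / p) else Ring.inverse (k : W p), ?_, ?_⟩
  · intro k z z' hz
    rcases k with _ | k
    · simp
    have hzp : z ≡ z' [MOD p] := hz.of_dvd (dvd_pow_self p k.succ_ne_zero)
    by_cases hpz : p ∣ z
    · have hpz' : p ∣ z' := (hzp.dvd_iff dvd_rfl).1 hpz
      obtain ⟨l, rfl⟩ := hpz
      obtain ⟨l', rfl⟩ := hpz'
      simp only [dvd_mul_right, if_true, Nat.mul_div_cancel_left _ hp.out.pos]
      rw [pow_succ'] at hz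
      -- Dividing `z` by `p` loses one digit; the factor `p` in front of `q` restores it.
      have h := hg.lip.neg k l l' (Nat.ModEq.mul_left_cancel' hp.out.ne_zero hz)
      rw [← mul_sub, add_zero, pow_succ']
      exact mul_dvd_mul_left _ h
    · have hpz' : ¬ p ∣ z' := fun h => hpz ((hzp.dvd_iff dvd_rfl).2 h)
      simp only [hpz, hpz', if_false]
      have h1 := witt_mul_inv hpz
      have h2 := witt_mul_inv hpz'
      have e : (p : W p) * Ring.inverse (z : W p) - p * Ring.inverse (z' : W p)
          = ((z : W p) - z') * (-(p * Ring.inverse (z : W p) * Ring.inverse (z' : W p))) := by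
        linear_combination (p * Ring.inverse (z' : W p)) * h1
          - (p * Ring.inverse (z : W p)) * h2
      rw [e]
      exact (dvd_cast_sub_cast hz).mul_right _
  · ext k
    rw [PowerSeries.coeff_map, PowerSeries.coeff_mk]
    rcases Nat.eq_zero_or_pos k with rfl | hk
    · rw [coeff_zero_hypG]
      simp only [dvd_zero, if_true, Nat.zero_div]
      have hA : wittCoeff hab 0 (State.empty b) 0 = 1 := by
        rw [wittCoeff, intCoeff_zero, map_one]
      have hpsi : ∑ i, psi (a i) - ∑ j, psi (b j) + eulerConst p
          = ((Φu 0 : ℤ_[p]) : ℚ_[p]) := by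
        rw [hu0]
        simp only [psi, Finset.sum_add_distrib, Finset.sum_const, Finset.card_univ,
          Fintype.card_fin, nsmul_eq_mul]
        push_cast
        ring
      have hg0 : ((gammaRatio a b 0)⁻¹ : ℤ_[p]ˣ).val = 1 := hΦu.inv.apply_zero
      have hpK : (p : K p) ≠ 0 := K_natCast_ne_zero p hp.out.ne_zero
      have hsum : algebraMap (W p) (K p) (- Φ 0)
          = qpToK p (∑ i, psi (a i) - ∑ j, psi (b j) + eulerConst p)
            - (p : K p)⁻¹ * logK p (algebraMap (W p) (K p) (1 + p * w)) := by
        rw [hpsi, qpToK_coe, ← hc0]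
        simp only [hΦ, hv0, hg0, mul_one, map_neg, map_add, map_mul, map_one,
          map_natCast]
        field_simp
        ring
      rw [hA, mul_one, hsum]
    · have hkK : (k : K p) ≠ 0 := K_natCast_ne_zero p hk.ne'
      rw [coeff_hypG hk.ne']
      simp only [← map_wittF hab, wittF, PowerSeries.coeff_map, PowerSeries.coeff_mk]
      by_cases hpk : p ∣ k
      · obtain ⟨l, rfl⟩ := hpk
        simp only [dvd_mul_right, if_true, Nat.mul_div_cancel_left _ hp.out.pos]
        rw [eq_div_iff hkK, ← map_natCast (algebraMap (W p) (K p)), ← map_pow, ← map_mul, ← map_mul,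
          ← map_sub]
        refine congrArg (algebraMap (W p) (K p)) ?_
        have h1 : wittCoeff hab 0 (State.empty b) (p * l) * v l
            = wittCoeff hab 1 (State.empty b) l := by
          rw [wittCoeff, wittCoeff, intCoeff_p_mul_eq, hv]
          simp only [← map_mul]
          refine congrArg (zpToW p) ?_
          have := (gammaRatio a b l).mul_inv
          linear_combination (intCoeff hab 1 (State.empty b) l) * this
        have h2 := hg.eq l
        rw [← h1]
        push_cast
        linear_combination (wittCoeff hab 0 (State.empty b) (p * l)) * h2
      · simp only [hpk, if_false, sub_zero]
        rw [eq_div_iff hkK, ← map_natCast (algebraMap (W p) (K p)), ← map_mul]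
        refine congrArg (algebraMap (W p) (K p)) ?_
        linear_combination (wittCoeff hab 0 (State.empty b) k) * witt_mul_inv hpk

end Weight

/-! ### Finiteness of the set of Dwork primes of a rational number. -/

section Orbits

variable {p : ℕ} [hp : Fact p.Prime]

/-- All iterates can be written with the denominator `d` of `α`. A numerator `m` is replaced by `(m
+ d l) / p` with `l ≤ p - 1`, which preserves `|m| ≤ B` as soon as `d ≤ B`. -/
theorem finite_range_dworkIter {α : ℤ_[p]} (hα : ∃ x : ℚ, (x : ℚ_[p]) = α) :
    (Set.range fun i => dworkIter i α).Finite := by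
  obtain ⟨x, hx⟩ := hα
  set d := x.den with hd
  have hd0 : (d : ℤ_[p]) ≠ 0 := by exact_mod_cast x.den_ne_zero
  set B : ℤ := |x.num| + d with hB
  have hinv : ∀ i, ∃ m : ℤ, |m| ≤ B ∧ (d : ℤ_[p]) * dworkIter i α = m := by
    intro i
    induction i with
    | zero =>
      refine ⟨x.num, by simp [hB], ?_⟩
      apply PadicInt.ext
      have h1 : (d : ℚ) * x = x.num := Rat.den_mul_eq_num x
      have h2 := congrArg (fun y : ℚ => (y : ℚ_[p])) h1
      simp only [Rat.cast_mul, Rat.cast_natCast, Rat.cast_intCast, hx] at h2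
      simpa [dworkIter] using h2
    | succ i ih =>
      obtain ⟨m, hm, he⟩ := ih
      set l := digitZero (dworkIter i α) with hl
      have hpl : (l : ℤ) < p := by exact_mod_cast digitZero_lt (dworkIter i α)
      have h1 : ((m + d * l : ℤ) : ℤ_[p]) = p * (d * dworkIter (i + 1) α) := by
        have := add_digitZero (dworkIter i α)
        rw [dworkIter_succ]
        push_cast
        rw [← he]
        linear_combination (d : ℤ_[p]) * this
      have h2 : (p : ℤ) ∣ m + d * l := by
        rw [← PadicInt.norm_int_lt_one_iff_dvd (p := p), PadicInt.norm_lt_one_iff_dvd, h1]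
        exact dvd_mul_right _ _
      obtain ⟨m', hm'⟩ := h2
      refine ⟨m', ?_, ?_⟩
      · have hp1 : (1 : ℤ) < p := by exact_mod_cast hp.out.one_lt
        have hl0 : (0 : ℤ) ≤ l := Int.natCast_nonneg l
        have hd1 : (0 : ℤ) ≤ d := Int.natCast_nonneg d
        have hdB : (d : ℤ) ≤ B := by rw [hB]; linarith [abs_nonneg x.num]
        have h3 : (d : ℤ) * l ≤ B * (p - 1) :=
          mul_le_mul hdB (by omega) hl0 (hd1.trans hdB)
        have h4 : (p : ℤ) * |m'| ≤ p * B := by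
          rw [← abs_of_pos (show (0 : ℤ) < p by omega), ← abs_mul, ← hm',
            abs_of_pos (show (0 : ℤ) < p by omega)]
          calc |m + d * l| ≤ |m| + |(d : ℤ) * l| := abs_add_le _ _
            _ ≤ B + B * (p - 1) := by
              rw [abs_of_nonneg (mul_nonneg hd1 hl0)]; exact add_le_add hm h3
            _ = p * B := by ring
        exact le_of_mul_le_mul_left h4 (by omega)
      · refine mul_left_cancel₀ (p_ne_zero (p := p)) ?_
        rw [← h1, hm']; push_cast; ring
  choose m hmB hm using hinv
  refine Set.Finite.of_finite_image (f := fun β => (d : ℤ_[p]) * β) ?_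
    (mul_right_injective₀ hd0).injOn
  refine (((Set.finite_Icc (-B) B).image fun m : ℤ => (m : ℤ_[p]))).subset ?_
  rintro _ ⟨_, ⟨i, rfl⟩, rfl⟩
  exact ⟨m i, abs_le.1 (hmB i), (hm i).symm⟩

theorem exists_bound_of_finite_range {X : Type*} {f : ℕ → X} (hf : (Set.range f).Finite) :
    ∃ N, ∀ i, ∃ k ≤ N, f k = f i := by
  classical
  obtain ⟨N, hN⟩ := (hf.image (Function.invFun f)).bddAbove
  exact ⟨N, fun i => ⟨Function.invFun f (f i), hN ⟨f i, ⟨i, rfl⟩, rfl⟩,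
    Function.invFun_eq ⟨i, rfl⟩⟩⟩

theorem Admissible.exists_period {r : ℕ} {a : Fin (r + 1) → ℤ_[p]} {b : Fin r → ℤ_[p]}
    (hab : Admissible a b) : ∃ N, ∀ i, ∃ k ≤ N, wittF hab k = wittF hab i := by
  have hpi : ∀ {s : ℕ} (c : Fin s → ℤ_[p]), (∀ i, ∃ x : ℚ, (x : ℚ_[p]) = c i) →
      (Set.range fun (i : ℕ) (k : Fin s) => dworkIter i (c k)).Finite := by
    intro s c hc
    refine (Set.Finite.pi' fun k => finite_range_dworkIter (hc k)).subset ?_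
    rintro _ ⟨i, rfl⟩ k
    exact ⟨i, rfl⟩
  have hfin : (Set.range fun i : ℕ => ((fun k => dworkIter i (a k) : Fin (r + 1) → ℤ_[p]),
      (fun k => dworkIter i (b k) : Fin r → ℤ_[p]))).Finite := by
    refine ((hpi a hab.rational_a).prod (hpi b hab.rational_b)).subset ?_
    rintro _ ⟨i, rfl⟩
    exact ⟨⟨i, rfl⟩, ⟨i, rfl⟩⟩
  obtain ⟨N, hN⟩ := exists_bound_of_finite_range hfin
  refine ⟨N, fun i => ?_⟩
  obtain ⟨k, hk, hki⟩ := hN i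
  refine ⟨k, hk, PowerSeries.map_injective _ (IsFractionRing.injective (W p) (K p)) ?_⟩
  obtain ⟨h1, h2⟩ := Prod.mk.inj hki
  rw [map_wittF, map_wittF, hypF, hypF, h1, h2]

end Orbits

/-! ### Inverses modulo `p^n` and divisibility of power series. -/

section Algebra

/-- Truncated geometric series in `p z / u`. -/
theorem exists_approx_inverse {L : Type*} [CommRing L] {u x z : L} {p : ℕ} (hu : IsUnit u)
    (hx : x = u + p * z) (n : ℕ) : ∃ y, (p : L) ^ n ∣ x * y - 1 := by
  obtain ⟨u, rfl⟩ := hu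
  set t : L := -(p * (z * (u⁻¹ : Lˣ))) with ht
  refine ⟨(u⁻¹ : Lˣ) * ∑ k ∈ Finset.range n, t ^ k, ?_⟩
  have h1 := mul_neg_geom_sum t n
  have h2 := u.mul_inv
  have h3 : x * (u⁻¹ : Lˣ) = 1 - t := by rw [hx, ht]; linear_combination h2
  rw [← mul_assoc, h3, h1, ht, neg_pow, mul_pow, sub_sub_cancel_left, dvd_neg]
  exact (dvd_mul_right _ _).mul_left _

theorem powerSeries_dvd_iff {R : Type*} [CommRing R] (c : R) (f : PowerSeries R) :
    PowerSeries.C c ∣ f ↔ ∀ n, c ∣ PowerSeries.coeff n f := by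
  constructor
  · rintro ⟨g, rfl⟩ n
    rw [PowerSeries.coeff_C_mul]
    exact dvd_mul_right _ _
  · intro h
    choose g hg using h
    refine ⟨PowerSeries.mk g, ?_⟩
    ext n
    rw [PowerSeries.coeff_C_mul, PowerSeries.coeff_mk, hg]

theorem powerSeries_natCast_pow_dvd_iff {R : Type*} [CommRing R] (p n : ℕ) (f : PowerSeries R) :
    (p : PowerSeries R) ^ n ∣ f ↔ ∀ k, (p : R) ^ n ∣ PowerSeries.coeff k f := by
  rw [← powerSeries_dvd_iff, map_pow, map_natCast]

end Algebra

/-! ### The Tate algebra inside `W[[t]]`. -/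

section Tate

variable {p : ℕ} [hp : Fact p.Prime] {h : (W p)[X]}

theorem toSeries_algebraMap (hu : IsUnit (h : PowerSeries (W p))) (g : (W p)[X]) :
    toSeries h hu (algebraMap _ (LocRing h) g) = (g : PowerSeries (W p)) :=
  IsLocalization.Away.lift_eq h hu g

theorem evalAt_algebraMap {α : W p} (hα : IsUnit (h.eval α)) (g : (W p)[X]) :
    evalAt h α hα (algebraMap _ (LocRing h) g) = g.eval α :=
  IsLocalization.Away.lift_eq h hα g

/-- Multiplying by a power of `h`, a unit in the localization, makes `y` a polynomial, for which
divisibility by `p^n` is tested on coefficients. -/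
theorem pow_dvd_of_toSeries (hu : IsUnit (h : PowerSeries (W p))) {n : ℕ} {y : LocRing h}
    (hy : (p : PowerSeries (W p)) ^ n ∣ toSeries h hu y) : (p : LocRing h) ^ n ∣ y := by
  obtain ⟨k, g, hg⟩ := IsLocalization.Away.surj h y
  have h1 := congrArg (toSeries h hu) hg
  rw [map_mul, map_pow, toSeries_algebraMap, toSeries_algebraMap] at h1
  have h2 : (p : PowerSeries (W p)) ^ n ∣ (g : PowerSeries (W p)) := by
    rw [← h1]; exact hy.mul_right _
  rw [powerSeries_natCast_pow_dvd_iff] at h2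
  have h3 : (p : (W p)[X]) ^ n ∣ g := by
    rw [← map_natCast (Polynomial.C : W p →+* (W p)[X]), ← map_pow, Polynomial.C_dvd_iff_dvd_coeff]
    intro k
    rw [← Polynomial.coeff_coe]; exact h2 k
  have h4 := map_dvd (algebraMap (W p)[X] (LocRing h)) h3
  rw [← hg, map_pow, map_natCast] at h4
  exact ((IsLocalization.Away.algebraMap_isUnit (S := LocRing h) h).pow k).dvd_mul_right.1 h4

theorem isImage_iff {B : Type*} [CommRing B] (φ : LocRing h →+* B) {f : TateAlg h} {X : B}
    {x : ℕ → LocRing h} (hx : ∀ n, AdicCompletion.evalₐ (Ideal.span {(p : LocRing h)}) n f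
      = Ideal.Quotient.mk _ (x n)) :
    IsImage φ f X ↔ ∀ n, (p : B) ^ n ∣ φ (x n) - X := by
  refine forall_congr' fun n => ?_
  rw [hx, Ideal.quotientMap_mk, Ideal.Quotient.mk_eq_mk_iff_sub_mem, mem_span_pow_iff_dvd]

/-- Elements of `W[t, h⁻¹]` that approximate a series `𝓕` define an element of the Tate algebra,
the only one with expansion `𝓕`. -/
theorem exists_tate_element (hu : IsUnit (h : PowerSeries (W p))) {𝓕 : PowerSeries (W p)}
    {x : ℕ → LocRing h} (hx : ∀ n, (p : PowerSeries (W p)) ^ n ∣ toSeries h hu (x n) - 𝓕) :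
    ∃ f : TateAlg h, (∀ n, AdicCompletion.evalₐ (Ideal.span {(p : LocRing h)}) n f
        = Ideal.Quotient.mk _ (x n)) ∧
      ∀ f' : TateAlg h, IsImage (toSeries h hu) f' 𝓕 ↔ f' = f := by
  have hc : ∀ n, (p : LocRing h) ^ n ∣ x n - x (n + 1) := by
    intro n
    refine pow_dvd_of_toSeries hu ?_
    rw [map_sub, ← sub_sub_sub_cancel_right _ _ 𝓕]
    exact dvd_sub (hx n) ((pow_dvd_pow _ n.le_succ).trans (hx (n + 1)))
  set I := Ideal.span {(p : LocRing h)} with hI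
  let s : AdicCompletion.AdicCauchySequence I (LocRing h) :=
    AdicCompletion.AdicCauchySequence.mk I (LocRing h) x fun n => by
      rw [SModEq.sub_mem, smul_eq_mul, Ideal.mul_top, mem_span_pow_iff_dvd]
      exact hc n
  have hev : ∀ n, AdicCompletion.evalₐ I n (AdicCompletion.mk I (LocRing h) s)
      = Ideal.Quotient.mk _ (x n) := fun n => AdicCompletion.evalₐ_mk I n s
  refine ⟨AdicCompletion.mk I (LocRing h) s, hev, fun f' => ⟨fun hf' => ?_, ?_⟩⟩
  · refine AdicCompletion.ext_evalₐ fun n => ?_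
    choose y hy using fun n =>
      Ideal.Quotient.mk_surjective (AdicCompletion.evalₐ I n f')
    have h1 := (isImage_iff (toSeries h hu) (fun n => (hy n).symm)).1 hf' n
    rw [hev, ← hy, Ideal.Quotient.mk_eq_mk_iff_sub_mem, mem_span_pow_iff_dvd]
    refine pow_dvd_of_toSeries hu ?_
    rw [map_sub, ← sub_sub_sub_cancel_right _ _ 𝓕]
    exact dvd_sub h1 (hx n)
  · rintro rfl
    exact (isImage_iff _ hev).2 hx

end Tate

/-! ### Assembly of the approximants. -/

section Main

variable {p : ℕ} [hp : Fact p.Prime] {r : ℕ} {a : Fin (r + 1) → ℤ_[p]} {b : Fin r → ℤ_[p]}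

/-- The polynomial `∏_{i ≤ N} [F^{(i)}]_{<p}` over `W`. -/
def wittPoly (hab : Admissible a b) (N : ℕ) : (W p)[X] :=
  ∏ i ∈ Finset.range (N + 1), PowerSeries.trunc p (wittF hab i)

theorem map_wittPoly (hab : Admissible a b) (N : ℕ) :
    (wittPoly hab N).map (algebraMap (W p) (K p)) = hypPoly a b N := by
  simp only [wittPoly, hypPoly, Polynomial.map_prod, ← PowerSeries.trunc_map, map_wittF]

theorem constantCoeff_wittF (hab : Admissible a b) (n : ℕ) :
    PowerSeries.constantCoeff (wittF hab n) = 1 := by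
  rw [← PowerSeries.coeff_zero_eq_constantCoeff_apply, wittF, PowerSeries.coeff_mk, wittCoeff,
    intCoeff_zero, map_one]

theorem isUnit_wittF (hab : Admissible a b) (n : ℕ) : IsUnit (wittF hab n) := by
  rw [PowerSeries.isUnit_iff_constantCoeff, constantCoeff_wittF]
  exact isUnit_one

theorem isUnit_wittPoly (hab : Admissible a b) (N : ℕ) :
    IsUnit (wittPoly hab N : PowerSeries (W p)) := by
  rw [PowerSeries.isUnit_iff_constantCoeff, Polynomial.constantCoeff_coe, wittPoly,
    Polynomial.coeff_zero_prod]
  have : ∀ i, (PowerSeries.trunc p (wittF hab i)).coeff 0 = 1 := fun i => by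
    rw [PowerSeries.coeff_trunc, if_pos hp.out.pos, PowerSeries.coeff_zero_eq_constantCoeff_apply,
      constantCoeff_wittF]
  simp [this]

theorem natCast_dvd_trunc_wittF_sub (hab : Admissible a b) (m : ℕ) :
    (p : (W p)[X]) ∣ PowerSeries.trunc (p ^ m) (wittF hab 0)
      - ∏ k ∈ Finset.range m, PowerSeries.trunc p (wittF hab k) ^ p ^ k := by
  have h := (isDworkSystem_intCoeff hab).dvd_trunc_sub_prod (intCoeff_zero hab) m 0
  have h' := map_dvd (Polynomial.mapRingHom (zpToW p)) h
  have hw : ∀ k, wittF hab k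
      = PowerSeries.map (zpToW p) (PowerSeries.mk (intCoeff hab k (State.empty b))) := by
    intro k; ext z; simp [wittF, wittCoeff]
  simpa only [map_natCast, map_sub, map_prod, map_pow, Polynomial.coe_mapRingHom,
    ← PowerSeries.trunc_map, ← hw, zero_add] using h'

/-- Modulo `p` the truncation is a product of powers of the `F^{(k)}_{<p}`, each of which equals
some factor of the polynomial that is inverted. -/
theorem exists_trunc_eq_unit_add (hab : Admissible a b) {N₀ N : ℕ}
    (hN₀ : ∀ i, ∃ k ≤ N₀, wittF hab k = wittF hab i) (hN : N₀ ≤ N) (m : ℕ) :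
    ∃ u z : LocRing (wittPoly hab N), IsUnit u ∧
      algebraMap _ (LocRing (wittPoly hab N)) (PowerSeries.trunc (p ^ m) (wittF hab 0))
        = u + p * z := by
  obtain ⟨z, hz⟩ := natCast_dvd_trunc_wittF_sub hab m
  refine ⟨algebraMap _ _ (∏ k ∈ Finset.range m, PowerSeries.trunc p (wittF hab k) ^ p ^ k),
    algebraMap _ _ z, ?_, ?_⟩
  · rw [map_prod]
    refine IsUnit.prod_iff.2 fun k _ => ?_
    rw [map_pow]
    refine IsUnit.pow _ ?_
    obtain ⟨k', hk', e⟩ := hN₀ k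
    refine isUnit_of_dvd_unit (map_dvd _ ?_)
      (IsLocalization.Away.algebraMap_isUnit (S := LocRing (wittPoly hab N)) (wittPoly hab N))
    rw [← e]
    exact Finset.dvd_prod_of_mem (fun i => PowerSeries.trunc p (wittF hab i))
      (Finset.mem_range.2 (by omega))
  · rw [← sub_add_cancel (PowerSeries.trunc (p ^ m) (wittF hab 0))
      (∏ k ∈ Finset.range m, PowerSeries.trunc p (wittF hab k) ^ p ^ k), hz, map_add, map_mul,
      map_natCast, add_comm]

theorem isUnit_of_eq_add {u z x : W p} (hu : IsUnit u) (hx : x = u + p * z) : IsUnit x := by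
  by_contra h
  have h1 := (IsLocalRing.mem_maximalIdeal _).2 h
  have h2 : (p : W p) * z ∈ IsLocalRing.maximalIdeal (W p) :=
    Ideal.mul_mem_right _ _ ((IsLocalRing.mem_maximalIdeal _).2
      (WittVector.irreducible p).not_isUnit)
  have h3 := Ideal.sub_mem _ h1 h2
  rw [hx, add_sub_cancel_right] at h3
  exact (IsLocalRing.mem_maximalIdeal _).1 h3 hu

theorem eval_trunc_map (f : PowerSeries (W p)) (n : ℕ) (α : W p) :
    (PowerSeries.trunc n (PowerSeries.map (algebraMap (W p) (K p)) f)).eval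
      (algebraMap (W p) (K p) α) = algebraMap (W p) (K p) ((PowerSeries.trunc n f).eval α) := by
  rw [PowerSeries.trunc_map, Polynomial.eval_map, Polynomial.eval₂_at_apply]

theorem exists_hypLog_element (hab : Admissible a b) {N₀ N : ℕ}
    (hN₀ : ∀ i, ∃ k ≤ N₀, wittF hab k = wittF hab i) (hN : N₀ ≤ N) (w : W p) :
    ∃ (𝓕 G : PowerSeries (W p)) (x y : ℕ → LocRing (wittPoly hab N)),
      PowerSeries.map (algebraMap (W p) (K p)) G = hypG a b (1 + p * w) ∧
      PowerSeries.map (algebraMap (W p) (K p)) 𝓕 = hypLog a b (1 + p * w) ∧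
      (∀ n, x n = algebraMap _ _ (PowerSeries.trunc (p ^ (n + 1)) G) * y n) ∧
      (∀ n, (p : LocRing (wittPoly hab N)) ^ n ∣
        algebraMap _ _ (PowerSeries.trunc (p ^ (n + 1)) (wittF hab 0)) * y n - 1) ∧
      ∀ n, (p : PowerSeries (W p)) ^ n ∣
        toSeries (wittPoly hab N) (isUnit_wittPoly hab N) (x n) - 𝓕 := by
  obtain ⟨q, hq, hG⟩ := exists_weight hab w
  set G : PowerSeries (W p) :=
    PowerSeries.mk fun k => q k * wittCoeff hab 0 (State.empty b) k with hGdef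
  obtain ⟨U, hU⟩ := isUnit_wittF hab 0
  have happ : ∀ n, ∃ y : LocRing (wittPoly hab N), (p : LocRing (wittPoly hab N)) ^ n ∣
      algebraMap _ _ (PowerSeries.trunc (p ^ (n + 1)) (wittF hab 0)) * y - 1 := by
    intro n
    obtain ⟨u, z, hu, he⟩ := exists_trunc_eq_unit_add hab hN₀ hN (n + 1)
    exact exists_approx_inverse hu he n
  choose y hy using happ
  refine ⟨G * (U⁻¹ : (PowerSeries (W p))ˣ), G, fun n =>
    algebraMap _ _ (PowerSeries.trunc (p ^ (n + 1)) G) * y n, y, hG, ?_, fun _ => rfl, hy, ?_⟩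
  · have hF : PowerSeries.constantCoeff (hypF a b 0) ≠ 0 := by
      rw [← map_wittF hab, ← PowerSeries.coeff_zero_eq_constantCoeff_apply, PowerSeries.coeff_map,
        PowerSeries.coeff_zero_eq_constantCoeff_apply, constantCoeff_wittF, map_one]
      exact one_ne_zero
    rw [hypLog, PowerSeries.eq_mul_inv_iff_mul_eq hF, ← map_wittF hab, ← map_mul, ← hG, mul_assoc,
      ← hU, Units.inv_mul, mul_one]
  · intro n
    have h1 : (p : PowerSeries (W p)) ^ n ∣
        G * (PowerSeries.trunc (p ^ (n + 1)) (wittF hab 0) : PowerSeries (W p))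
          - (PowerSeries.trunc (p ^ (n + 1)) G : PowerSeries (W p)) * wittF hab 0 :=
      (powerSeries_natCast_pow_dvd_iff p n _).2 fun k =>
        pow_dvd_coeff_mul_trunc_sub (witt_p_ne_zero p) (isDworkSystem_wittCoeff hab) hq 0 n k
    have h2 := map_dvd (toSeries (wittPoly hab N) (isUnit_wittPoly hab N)) (hy n)
    rw [map_pow, map_natCast, map_sub, map_mul, toSeries_algebraMap, map_one] at h2
    rw [map_mul, toSeries_algebraMap]
    generalize toSeries (wittPoly hab N) (isUnit_wittPoly hab N) (y n) = Y at *
    rw [← hU] at h1 h2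
    generalize (PowerSeries.trunc (p ^ (n + 1)) (U : PowerSeries (W p)) : PowerSeries (W p)) = f
      at *
    generalize (PowerSeries.trunc (p ^ (n + 1)) G : PowerSeries (W p)) = g at *
    have h3 := U.inv_mul
    -- Two errors are separated: that of the Dwork congruence, and that of `Y` as an inverse of the
    -- truncation of `F`.
    have e : g * Y - G * (U⁻¹ : (PowerSeries (W p))ˣ)
        = (G * f - g * U) * (-((U⁻¹ : (PowerSeries (W p))ˣ) * Y))
          + (f * Y - 1) * (G * (U⁻¹ : (PowerSeries (W p))ˣ)) := by
      linear_combination (-(g * Y)) * h3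
    rw [e]
    exact dvd_add (h1.mul_right _) (h2.mul_right _)

end Main

end

end LogHypergeometric

theorem corollary3p4 (p : ℕ) [Fact p.Prime] {r : ℕ}
    (a : Fin (r + 1) → ℤ_[p]) (b : Fin r → ℤ_[p]) (hab : Admissible a b) :
    ∃ N₀ : ℕ, ∀ N : ℕ, N₀ ≤ N →
      ∃ h : (W p)[X], h.map (algebraMap (W p) (K p)) = hypPoly a b N ∧
      ∃ hu : IsUnit (h : PowerSeries (W p)),
      ∀ c : W p, (∃ w : W p, c = 1 + p * w) →
        ∃ 𝓕 : PowerSeries (W p),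
          PowerSeries.map (algebraMap (W p) (K p)) 𝓕 = hypLog a b c ∧
          ∃ f : TateAlg h,
            (∀ f' : TateAlg h, IsImage (toSeries h hu) f' 𝓕 ↔ f' = f) ∧
            ∀ α : W p, padicAbs p (algebraMap (W p) (K p) (h.eval α)) = 1 →
              ∃ hα : IsUnit (h.eval α),
              ∃ v : W p,
                (∀ v' : W p, IsImage (evalAt h α hα) f v' ↔ v' = v) ∧
                (∀ n : ℕ, (PowerSeries.trunc (p ^ n) (hypF a b 0)).eval
                  (algebraMap (W p) (K p) α) ≠ 0) ∧
                IsPadicLimit p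
                  (fun n => (PowerSeries.trunc (p ^ n) (hypG a b c)).eval
                      (algebraMap (W p) (K p) α) /
                    (PowerSeries.trunc (p ^ n) (hypF a b 0)).eval
                      (algebraMap (W p) (K p) α))
                  (algebraMap (W p) (K p) v) := by
  obtain ⟨N₀, hN₀⟩ := hab.exists_period
  refine ⟨N₀, fun N hN => ⟨wittPoly hab N, map_wittPoly hab N, isUnit_wittPoly hab N, ?_⟩⟩
  rintro c ⟨w, rfl⟩
  obtain ⟨𝓕, G, x, y, hG, h𝓕, hxy, hy, hx⟩ := exists_hypLog_element hab hN₀ hN w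
  obtain ⟨f, hf, hfu⟩ := exists_tate_element (isUnit_wittPoly hab N) hx
  refine ⟨𝓕, h𝓕, f, hfu, fun α hα1 => ?_⟩
  have hα := isUnit_of_padicAbs_eq_one p hα1
  set e := evalAt (wittPoly hab N) α hα with he
  have hcauchy : ∀ n, (p : W p) ^ n ∣ e (x (n + 1)) - e (x n) := by
    intro n
    have h1 : (p : LocRing (wittPoly hab N)) ^ n ∣ x (n + 1) - x n := by
      refine pow_dvd_of_toSeries (isUnit_wittPoly hab N) ?_
      rw [map_sub, ← sub_sub_sub_cancel_right _ _ 𝓕]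
      exact dvd_sub ((pow_dvd_pow _ n.le_succ).trans (hx (n + 1))) (hx n)
    have h2 := map_dvd e h1
    rwa [map_pow, map_natCast, map_sub] at h2
  obtain ⟨v, hv⟩ := witt_exists_limit p (fun n => e (x n)) hcauchy
  -- Unlike in the localization, in the local ring `W` a unit plus a multiple of `p` is a unit, so
  -- the truncations of `F` take unit values at `α`.
  have hunit : ∀ m, IsUnit ((PowerSeries.trunc (p ^ m) (wittF hab 0)).eval α) := by
    intro m
    obtain ⟨u, z, hu, hz⟩ := exists_trunc_eq_unit_add hab hN₀ hN m
    have h1 := congrArg e hz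
    rw [he, evalAt_algebraMap, map_add, map_mul, map_natCast] at h1
    exact isUnit_of_eq_add (hu.map _) h1
  refine ⟨hα, v, fun v' => ?_, fun n => ?_, ?_⟩
  · rw [isImage_iff _ hf]
    constructor
    · intro h
      refine witt_eq_of_dvd p fun n => ?_
      rw [← sub_sub_sub_cancel_left _ _ (e (x n))]
      exact dvd_sub (hv n) (h n)
    · rintro rfl; exact hv
  · rw [← map_wittF hab, eval_trunc_map, Ne,
      map_eq_zero_iff _ (IsFractionRing.injective (W p) (K p))]
    exact (hunit n).ne_zero
  · choose F hF using hunit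
    have e1 : ∀ n, (PowerSeries.trunc (p ^ n) (hypG a b (1 + p * w))).eval
          (algebraMap (W p) (K p) α) /
        (PowerSeries.trunc (p ^ n) (hypF a b 0)).eval (algebraMap (W p) (K p) α)
        = algebraMap (W p) (K p) ((PowerSeries.trunc (p ^ n) G).eval α * ((F n)⁻¹ : (W p)ˣ)) := by
      intro n
      rw [← map_wittF hab, ← hG, eval_trunc_map, eval_trunc_map, ← hF, div_eq_iff, ← map_mul,
        mul_assoc, Units.inv_mul, mul_one]
      rw [Ne, map_eq_zero_iff _ (IsFractionRing.injective (W p) (K p))]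
      exact (F n).ne_zero
    simp only [e1]
    refine isPadicLimit_of_dvd p fun n => ?_
    -- The approximant built from truncations at `p^(k+1)` is controlled only mod `p^k`, hence `m ≥
    -- n + 1`.
    filter_upwards [eventually_ge_atTop (n + 1)] with m hm
    obtain ⟨k, rfl⟩ : ∃ k, m = k + 1 := ⟨m - 1, by omega⟩
    refine (pow_dvd_pow _ (show n ≤ k by omega)).trans ?_
    have h1 := map_dvd e (hy k)
    rw [map_pow, map_natCast, map_sub, map_mul, map_one, he, evalAt_algebraMap, ← hF, ← he] at h1
    have h2 := hv k
    simp only [hxy, map_mul] at h2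
    rw [he, evalAt_algebraMap, ← he] at h2
    have h3 := (F (k + 1)).inv_mul
    have e2 : (PowerSeries.trunc (p ^ (k + 1)) G).eval α * ((F (k + 1))⁻¹ : (W p)ˣ) - v
        = ((PowerSeries.trunc (p ^ (k + 1)) G).eval α * e (y k) - v)
          - (F (k + 1) * e (y k) - 1)
            * ((PowerSeries.trunc (p ^ (k + 1)) G).eval α * ((F (k + 1))⁻¹ : (W p)ˣ)) := by
      linear_combination ((PowerSeries.trunc (p ^ (k + 1)) G).eval α * e (y k)) * h3
    rw [e2]
    exact dvd_sub h2 (h1.mul_right _)
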